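/- Consider the synchronous CONGEST model: a network is a connected undirected graph $G$ on $n$ nodes with distinct identifiers $1,\dots,n$; initially each node knows $n$, its own identifier and those of its neighbours, and in each round each node may send a (possibly different) message of at most $b=O(\log n)$ bits to each of its neighbours; local computation is unlimited, and the nodes may use (even shared) random coins. The radius of $G$ is $\min_{u}\max_{v} d(u,v)$. Then computing the exact radius needs $\Omega(n/\log^3 n)$ rounds, even on networks of maximum degree $5$ (which have at most $5n/2$ edges) and even for randomized protocols. Precisely: for every $C$ and every $\varepsilon<1/2$ there are $c>0$ and $N$ such that for all $n\ge N$ and all $b\le C\log n$ the following holds. If a (possibly randomized) protocol with messages of at most $b$ bits is such that on every connected $n$-node network $G$ of maximum degree $5$, with probability at least $1-\varepsilon$, after $T$ rounds at least one node has produced an output and every output produced equals the radius of $G$ (for instance, all nodes output the radius), then $T\ge c\,n/\log^3 n$. -/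

import Mathlib

universe u v

namespace Congest

/-- A message of at most `b` bits: a length `l ≤ b` and `l` bits. The empty string serves as
silence. -/
abbrev Message (b : ℕ) : Type := (l : Fin (b + 1)) × (Fin l → Bool)

/-- A protocol for networks of `n` nodes, with identifiers in `Fin n`, in the synchronous
message-passing model with messages of at most `b` bits.

Local computation is unrestricted, and the protocol may depend on `n`. Initially a node knows its
own identifier, the identifiers of its neighbours, and the outcome `ω : Coins` of the randomness.
The randomness is shared by all nodes; private coins are the case in which each node looks only
at its own component of `ω`, and deterministic protocols are the case in which `ω` is ignored. -/
structure Protocol (Coins : Type u) (n b : ℕ) where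
  /-- local states of a node -/
  State : Type v
  /-- initial state, from the coins, the own identifier and the set of neighbours -/
  init : Coins → Fin n → Set (Fin n) → State
  /-- `send s w` is the message that a node in state `s` sends to its neighbour `w`;
  different neighbours may get different messages -/
  send : State → Fin n → Message b
  /-- new state, from the old one and the messages received in this round (`none` at a node
  that is not a neighbour) -/
  receive : State → (Fin n → Option (Message b)) → State
  /-- the output that a node announces in a given state, if any -/
  output : State → Option ℕ

namespace Protocol

variable {Coins : Type u} {n b : ℕ}

open Classical in
/-- The state of each node of the network `G` after `t` rounds. -/
noncomputable def stateAfter (P : Protocol.{u, v} Coins n b) (G : SimpleGraph (Fin n))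
    (ω : Coins) : ℕ → Fin n → P.State
  | 0, x => P.init ω x (G.neighborSet x)
  | t + 1, x => P.receive (P.stateAfter G ω t x)
      (fun y => if G.Adj x y then some (P.send (P.stateAfter G ω t y) x) else none)

/-- With coins `ω`, after `T` rounds on `G` at least one node has an output, and each output is
the radius of `G`. (In particular this holds when all nodes output the radius.) -/
def OutputsRadius (P : Protocol.{u, v} Coins n b) (G : SimpleGraph (Fin n)) (T : ℕ)
    (ω : Coins) : Prop :=
  (∃ x, P.output (P.stateAfter G ω T x) ≠ none) ∧
    ∀ x r, P.output (P.stateAfter G ω T x) = some r → G.radius = (r : ℕ∞)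

end Protocol

open Classical in
/-- Connected networks on `n` nodes whose maximum degree is `5`. Such a network has at most
`5 * n / 2` edges. -/
def IsNetworkOfMaxDegreeFive {n : ℕ} (G : SimpleGraph (Fin n)) : Prop :=
  G.Connected ∧ G.maxDegree = 5

/-- On every connected `n`-node network of maximum degree `5`, the protocol computes the radius
within `T` rounds, with error probability at most `ε` over the coins. -/
def Protocol.ComputesRadiusWithin {Coins : Type u} [MeasurableSpace Coins] {n b : ℕ}
    (P : Protocol.{u, v} Coins n b) (μ : MeasureTheory.Measure Coins) (ε : ℝ) (T : ℕ) : Prop :=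
  ∀ G : SimpleGraph (Fin n), IsNetworkOfMaxDegreeFive G →
    MeasurableSet {ω | P.OutputsRadius G T ω} ∧ 1 - ε ≤ μ.real {ω | P.OutputsRadius G T ω}

end Congest

/-! Set disjointness on `2 ^ L - 1` elements is encoded in the radius of a network that a cut of
only `2 * (L + 1)` links splits between two players, Alice with input `x` and Bob with input `y`.

Network. Alice's line `i` enters, at height `h`, the tree of bit `h` of `i`; Bob's line `j` enters
the tree of the complementary bit of `j`; corresponding roots are linked across the cut. So `alice i
0` reaches the end of Bob's line `j` in `6 * L + 9` steps as soon as `i` and `j` differ in some bit.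
For `j = i` this route is missing; at position `L`, where every index has bit `0`, the input link
supplies it exactly when `y i`. The end of the path below `sel` is within `6 * L + 9` of `alice i 0`
exactly when `x i`, and of no other node of the lines and bit trees, while `sel`, the path and the
padding are too far from the ends of Bob's lines. Hence the radius is `6 * L + 9` iff the sets meet
(`network_radius_eq_iff`). Lower bounds on distances come from functions that change by at most one
along links.

Simulation. For fixed coins, the messages over the cut partition the input pairs into rectangles
(`labelledTranscript_rectangle`), and the logarithm of their number is `O(b * T * L)`.

Disjointness. A random mask `z` confines Alice's set to `z` and Bob's to its complement; then an
element `i` is planted in both sets or in neither. For each rectangle the level-one inequality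
bounds how much one player's planted bit matters; entropy sums this to `O(log |Γ|)` over all `i` and
all rectangles (`expect_sum_hellinger_le`). `cut_and_paste` passes to changing both bits at once. A
protocol with error `ε` has total advantage at least `1 - 2 * ε` per element, so `log |Γ|` is at
least of order `2 ^ L` (`randomized_disjointness`).

The three logarithms in the result are the message length, the cut size, and the ratio of `n` to `2
^ L`. -/

namespace Congest

/-! ### Fourier and Hellinger estimates for rectangle partitions. -/

section Disjointness

open Finset Function
open scoped BigOperators

variable {ι : Type*} [Fintype ι] [DecidableEq ι]

/-- The sign `1` of `false` and `-1` of `true`. -/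
def bitSign (c : Bool) : ℝ := if c then -1 else 1

theorem expect_update (i : ι) (F : (ι → Bool) → ℝ) :
    𝔼 u, F u = (𝔼 u, F (update u i true) + 𝔼 u, F (update u i false)) / 2 := by
  have hinv : Function.Involutive (fun u : ι → Bool => update u i (!u i)) := by
    intro u; funext j; by_cases h : j = i
    · subst h; simp
    · simp [h]
  have h1 : 𝔼 u, F (update u i (!u i)) = 𝔼 u, F u :=
    Fintype.expect_equiv hinv.toPerm _ _ (fun u => rfl)
  have h2 : 𝔼 u, F (update u i true) + 𝔼 u, F (update u i false)
      = 𝔼 u, F u + 𝔼 u, F (update u i (!u i)) := by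
    rw [← expect_add_distrib, ← expect_add_distrib]
    refine expect_congr rfl fun u _ => ?_
    have h3 : update u i (u i) = u := update_eq_self i u
    cases h : u i <;> rw [h] at h3 <;> simp [h3, add_comm]
  rw [h2, h1]; ring

theorem expect_exp_bitSign (l : ι → ℝ) :
    𝔼 u : ι → Bool, Real.exp (∑ i, l i * bitSign (u i)) = ∏ i, Real.cosh (l i) := by
  have h : ∏ i, ∑ c : Bool, Real.exp (l i * bitSign c) / 2
      = ∑ u : ι → Bool, ∏ i, Real.exp (l i * bitSign (u i)) / 2 := by
    rw [Finset.prod_univ_sum, Fintype.piFinset_univ]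
  rw [Fintype.expect_eq_sum_div_card, Finset.sum_div]
  have h2 : ∏ i, Real.cosh (l i) = ∏ i, ∑ c : Bool, Real.exp (l i * bitSign c) / 2 := by
    refine prod_congr rfl fun i _ => ?_
    simp [Real.cosh_eq, bitSign]; ring
  rw [h2, h]
  refine sum_congr rfl fun u _ => ?_
  rw [Real.exp_sum, Finset.prod_div_distrib]; simp

/-- The level-one inequality on the cube. -/
theorem level_one_inequality (f : (ι → Bool) → ℝ) (h0 : ∀ u, 0 ≤ f u) (h1 : ∀ u, f u ≤ 1)
    (hpos : 0 < 𝔼 u, f u) :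
    ∑ i, (𝔼 u, f u * bitSign (u i)) ^ 2 ≤ 2 * (𝔼 u, f u) ^ 2 * (- Real.log (𝔼 u, f u)) := by
  set α := 𝔼 u, f u with hα
  -- With this direction, `g` has mean `M` under the density `f / α`. Comparing exponential moments
  -- of `g` under that density and under the uniform one gives `M + log α ≤ M / 2`.
  set l : ι → ℝ := fun i => (𝔼 u, f u * bitSign (u i)) / α with hl
  set g : (ι → Bool) → ℝ := fun u => ∑ i, l i * bitSign (u i) with hg
  set M := ∑ i, l i ^ 2 with hM
  have hfg : 𝔼 u, f u * g u = α * M := by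
    have : ∀ u, f u * g u = ∑ i, l i * (f u * bitSign (u i)) := by
      intro u; rw [hg, mul_sum]; exact sum_congr rfl fun i _ => by ring
    simp_rw [this]
    rw [expect_sum_comm, hM, mul_sum]
    refine sum_congr rfl fun i _ => ?_
    rw [← mul_expect]
    have : 𝔼 u, f u * bitSign (u i) = l i * α := by rw [hl]; field_simp
    rw [this]; ring
  -- Jensen's inequality, by the tangent line of `exp` at `M`.
  have hlow : Real.exp M * α ≤ 𝔼 u, f u * Real.exp (g u) := by
    have h3 : Real.exp M * α = 𝔼 u, Real.exp M * (f u + f u * g u - M * f u) := by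
      rw [← mul_expect, expect_sub_distrib, expect_add_distrib, ← mul_expect, hfg, ← hα]; ring
    rw [h3]
    refine expect_le_expect fun u _ => ?_
    have h4 : Real.exp (g u) = Real.exp M * Real.exp (g u - M) := by
      rw [← Real.exp_add]; congr 1; ring
    have h5 := Real.add_one_le_exp (g u - M)
    rw [h4]
    have h6 := mul_le_mul_of_nonneg_left h5 (mul_nonneg (Real.exp_pos M).le (h0 u))
    calc _ = Real.exp M * f u * (g u - M + 1) := by ring
      _ ≤ _ := h6
      _ = _ := by ring
  have hup : 𝔼 u, f u * Real.exp (g u) ≤ Real.exp (M / 2) := by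
    calc _ ≤ 𝔼 u, Real.exp (g u) := expect_le_expect fun u _ => by
            have := mul_le_mul_of_nonneg_right (h1 u) (Real.exp_pos (g u)).le
            simpa using this
      _ = ∏ i, Real.cosh (l i) := expect_exp_bitSign l
      _ ≤ ∏ i, Real.exp (l i ^ 2 / 2) :=
          prod_le_prod (fun i _ => (Real.cosh_pos _).le) fun i _ => Real.cosh_le_exp_half_sq _
      _ = _ := by rw [← Real.exp_sum, hM, sum_div]
  have hlog : M + Real.log α ≤ M / 2 := by
    have := Real.log_le_log (by positivity) (hlow.trans hup)
    rwa [Real.log_exp, Real.log_mul (Real.exp_pos _).ne' hpos.ne', Real.log_exp] at this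
  have h7 : ∑ i, (𝔼 u, f u * bitSign (u i)) ^ 2 = α ^ 2 * M := by
    rw [hM, mul_sum]
    refine sum_congr rfl fun i _ => ?_
    rw [hl]; field_simp
  rw [h7]
  nlinarith [sq_nonneg α]

theorem sum_negMulLog_le_log_card {Γ : Type*} [Fintype Γ] (p : Γ → ℝ) (h0 : ∀ c, 0 ≤ p c)
    (h1 : ∑ c, p c = 1) : ∑ c, p c * (- Real.log (p c)) ≤ Real.log (Fintype.card Γ) := by
  have hne : Nonempty Γ := by
    by_contra h
    rw [not_nonempty_iff] at h
    simp at h1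
  have hN : (0 : ℝ) < Fintype.card Γ := by exact_mod_cast Fintype.card_pos
  have key : ∀ c, p c * (- Real.log (p c)) ≤
      p c * Real.log (Fintype.card Γ) + (1 / (Fintype.card Γ : ℝ) - p c) := by
    intro c
    rcases (h0 c).eq_or_lt with h | h
    · rw [← h]; simp
    · have h2 := Real.log_le_sub_one_of_pos (x := 1 / (Fintype.card Γ * p c)) (by positivity)
      rw [one_div, Real.log_inv, Real.log_mul hN.ne' h.ne'] at h2
      have h3 := mul_le_mul_of_nonneg_left h2 h.le
      have h4 : p c * ((Fintype.card Γ * p c)⁻¹ - 1) = 1 / (Fintype.card Γ : ℝ) - p c := by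
        field_simp
      rw [h4] at h3
      linarith
  calc _ ≤ ∑ c, (p c * Real.log (Fintype.card Γ) + (1 / (Fintype.card Γ : ℝ) - p c)) :=
        sum_le_sum fun c _ => key c
    _ = _ := by
      rw [sum_add_distrib, sum_sub_distrib, ← sum_mul, h1]; simp

/-- The mean of `f` over the subcube of points that vanish outside of `z`. -/
noncomputable def subcubeMean (f : (ι → Bool) → ℝ) (z : ι → Bool) : ℝ :=
  𝔼 u : ι → Bool, f (fun j => z j && u j)

/-- The mean of `f` over points that vanish outside of `z`, after coordinate `i` is reset
to `c`. -/
noncomputable def plantedMean (f : (ι → Bool) → ℝ) (z : ι → Bool) (i : ι) (c : Bool) : ℝ :=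
  𝔼 u : ι → Bool, f (update (fun j => z j && u j) i c)

theorem plantedMean_update (f : (ι → Bool) → ℝ) (z : ι → Bool) (i : ι) (c d : Bool) :
    plantedMean f (update z i d) i c = plantedMean f z i c := by
  unfold plantedMean
  refine expect_congr rfl fun u _ => congrArg f ?_
  funext j
  by_cases h : j = i
  · subst h; simp
  · simp [h]

theorem plantedMean_nonneg {f : (ι → Bool) → ℝ} (h0 : ∀ u, 0 ≤ f u) (z i c) :
    0 ≤ plantedMean f z i c := expect_nonneg fun _ _ => h0 _

theorem plantedMean_not_update (f : (ι → Bool) → ℝ) (z : ι → Bool) (i : ι) (c d : Bool) :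
    plantedMean f (fun j => !(update z i d j)) i c = plantedMean f (fun j => !z j) i c := by
  rw [← plantedMean_update f (fun j => !z j) i c (!d)]
  congr 1
  funext j
  by_cases h : j = i
  · subst h; simp
  · simp [h]

theorem subcubeMean_of_false (f : (ι → Bool) → ℝ) (z : ι → Bool) (i : ι) (hz : z i = false) :
    subcubeMean f z = plantedMean f z i false := by
  unfold plantedMean subcubeMean
  refine expect_congr rfl fun u _ => congrArg f ?_
  funext j
  by_cases h : j = i
  · subst h; simp [hz]
  · simp [h]

theorem and_update_of_true {ι : Type*} [DecidableEq ι] (z u : ι → Bool) (i : ι) (hz : z i = true) (c : Bool) :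
    (fun j => z j && update u i c j) = update (fun j => z j && u j) i c := by
  funext j
  by_cases h : j = i
  · subst h; simp [hz]
  · simp [h]

theorem subcubeMean_of_true (f : (ι → Bool) → ℝ) (z : ι → Bool) (i : ι) (hz : z i = true) :
    subcubeMean f z = (plantedMean f z i true + plantedMean f z i false) / 2 := by
  unfold plantedMean subcubeMean
  rw [expect_update i]
  simp_rw [and_update_of_true z _ i hz]

theorem expect_bitSign_of_true (f : (ι → Bool) → ℝ) (z : ι → Bool) (i : ι) (hz : z i = true) :
    𝔼 u : ι → Bool, f (fun j => z j && u j) * bitSign (u i)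
      = (plantedMean f z i false - plantedMean f z i true) / 2 := by
  unfold plantedMean
  rw [expect_update i]
  simp_rw [and_update_of_true z _ i hz]
  simp [bitSign, expect_neg_distrib]
  ring

/-- Factor `a - b` through the square roots and use `(√a + √b) ^ 2 ≥ a + b`. This turns Fourier
coefficients into Hellinger terms. -/
theorem sq_sqrt_sub_sqrt_mul_add_le {a b : ℝ} (ha : 0 ≤ a) (hb : 0 ≤ b) :
    (√a - √b) ^ 2 * (a + b) ≤ (a - b) ^ 2 := by
  obtain ⟨x, hx, rfl⟩ : ∃ x, 0 ≤ x ∧ a = x ^ 2 := ⟨√a, by positivity, (Real.sq_sqrt ha).symm⟩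
  obtain ⟨y, hy, rfl⟩ : ∃ x, 0 ≤ x ∧ b = x ^ 2 := ⟨√b, by positivity, (Real.sq_sqrt hb).symm⟩
  rw [Real.sqrt_sq hx, Real.sqrt_sq hy]
  have : (x ^ 2 - y ^ 2) ^ 2 - (x - y) ^ 2 * (x ^ 2 + y ^ 2) = (x - y) ^ 2 * (2 * x * y) := by ring
  nlinarith [mul_nonneg (sq_nonneg (x - y)) (mul_nonneg (mul_nonneg zero_le_two hx) hy)]

/-- For `z i = true` the level-one coefficient is half the difference of the two planted means,
whose sum is twice the subcube mean `α`. Dividing the level-one inequality by `α` leaves `α * log (1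
/ α)`. -/
theorem sum_sq_sqrt_plantedMean_sub_le (f : (ι → Bool) → ℝ) (h0 : ∀ u, 0 ≤ f u)
    (h1 : ∀ u, f u ≤ 1) (z : ι → Bool) :
    ∑ i, (if z i then (√(plantedMean f z i true) - √(plantedMean f z i false)) ^ 2 else 0)
      ≤ 4 * (subcubeMean f z * (- Real.log (subcubeMean f z))) := by
  have hα0 : 0 ≤ subcubeMean f z := expect_nonneg fun _ _ => h0 _
  rcases hα0.eq_or_lt with h | h
  · rw [← h]
    simp only [zero_mul, mul_zero]
    refine (sum_eq_zero fun i _ => ?_).le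
    split_ifs with hz
    · have h2 := subcubeMean_of_true f z i hz
      have h3 := plantedMean_nonneg h0 z i true
      have h4 := plantedMean_nonneg h0 z i false
      have h5 : plantedMean f z i true = 0 := by linarith
      have h6 : plantedMean f z i false = 0 := by linarith
      simp [h5, h6]
    · rfl
  · have hlev := level_one_inequality (fun u => f (fun j => z j && u j)) (fun _ => h0 _)
      (fun _ => h1 _) h
    change _ ≤ 2 * (subcubeMean f z) ^ 2 * (- Real.log (subcubeMean f z)) at hlev
    set α := subcubeMean f z
    have hterm : ∀ i, (if z i then (√(plantedMean f z i true) - √(plantedMean f z i false)) ^ 2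
        else 0) ≤ (2 / α) * (𝔼 u : ι → Bool, f (fun j => z j && u j) * bitSign (u i)) ^ 2 := by
      intro i
      split_ifs with hz
      · have h2 := subcubeMean_of_true f z i hz
        have h3 := sq_sqrt_sub_sqrt_mul_add_le (plantedMean_nonneg h0 z i true)
          (plantedMean_nonneg h0 z i false)
        rw [expect_bitSign_of_true f z i hz]
        have h4 : plantedMean f z i true + plantedMean f z i false = 2 * α := by linarith
        rw [h4] at h3
        rw [div_mul_eq_mul_div, le_div_iff₀ h]
        linarith
      · positivity
    calc _ ≤ ∑ i, (2 / α) * (𝔼 u : ι → Bool, f (fun j => z j && u j) * bitSign (u i)) ^ 2 :=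
          sum_le_sum fun i _ => hterm i
      _ ≤ (2 / α) * (2 * α ^ 2 * (- Real.log α)) := by
          rw [← mul_sum]; exact mul_le_mul_of_nonneg_left hlev (by positivity)
      _ = _ := by field_simp; ring

variable {Γ : Type*} [Fintype Γ]

theorem subcubeMean_mul_subcubeMean_sum {a b : Γ → (ι → Bool) → ℝ}
    (hab : ∀ x y, ∑ c, a c x * b c y = 1) (z z' : ι → Bool) :
    ∑ c, subcubeMean (a c) z * subcubeMean (b c) z' = 1 := by
  unfold subcubeMean
  simp_rw [expect_mul_expect]
  rw [← expect_sum_comm]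
  simp_rw [← expect_sum_comm, hab]
  simp

theorem plantedMean_mul_plantedMean_sum {a b : Γ → (ι → Bool) → ℝ}
    (hab : ∀ x y, ∑ c, a c x * b c y = 1) (z z' : ι → Bool) (i : ι) (p q : Bool) :
    ∑ c, plantedMean (a c) z i p * plantedMean (b c) z' i q = 1 := by
  unfold plantedMean
  simp_rw [expect_mul_expect]
  rw [← expect_sum_comm]
  simp_rw [← expect_sum_comm, hab]
  simp

/-- Where `z i` holds, the complementary mask already makes the other player's bit false, so the
factor from `b` is a subcube mean independent of `i`. What remains is at most four times the entropy
of the distribution of the rectangle. -/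
theorem sum_hellinger_le_of_mask {a b : Γ → (ι → Bool) → ℝ} (ha0 : ∀ c x, 0 ≤ a c x)
    (ha1 : ∀ c x, a c x ≤ 1) (hb0 : ∀ c x, 0 ≤ b c x) (hb1 : ∀ c x, b c x ≤ 1)
    (hab : ∀ x y, ∑ c, a c x * b c y = 1) (z : ι → Bool) :
    ∑ i, (if z i then ∑ c, (√(plantedMean (a c) z i true) - √(plantedMean (a c) z i false)) ^ 2 *
        plantedMean (b c) (fun j => !z j) i false else 0) ≤ 4 * Real.log (Fintype.card Γ) := by
  have h1 : ∀ i, (if z i then ∑ c, (√(plantedMean (a c) z i true)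
      - √(plantedMean (a c) z i false)) ^ 2 * plantedMean (b c) (fun j => !z j) i false else 0)
      = ∑ c, (if z i then (√(plantedMean (a c) z i true)
        - √(plantedMean (a c) z i false)) ^ 2 else 0) * subcubeMean (b c) (fun j => !z j) := by
    intro i
    split_ifs with hz
    · refine sum_congr rfl fun c _ => ?_
      rw [subcubeMean_of_false (b c) (fun j => !z j) i (by simp [hz])]
    · simp
  simp_rw [h1]
  rw [sum_comm]
  simp_rw [← sum_mul]
  have hA0 : ∀ c, 0 ≤ subcubeMean (a c) z := fun c => expect_nonneg fun _ _ => ha0 _ _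
  have hB0 : ∀ c, 0 ≤ subcubeMean (b c) (fun j => !z j) := fun c => expect_nonneg fun _ _ => hb0 _ _
  have hB1 : ∀ c, subcubeMean (b c) (fun j => !z j) ≤ 1 := fun c =>
    expect_le univ_nonempty fun _ _ => hb1 _ _
  have hent := sum_negMulLog_le_log_card
    (fun c => subcubeMean (a c) z * subcubeMean (b c) (fun j => !z j))
    (fun c => mul_nonneg (hA0 c) (hB0 c)) (subcubeMean_mul_subcubeMean_sum hab z _)
  calc _ ≤ ∑ c, 4 * (subcubeMean (a c) z * subcubeMean (b c) (fun j => !z j) *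
        (- Real.log (subcubeMean (a c) z * subcubeMean (b c) (fun j => !z j)))) := by
        refine sum_le_sum fun c _ => ?_
        have h2 := mul_le_mul_of_nonneg_right
          (sum_sq_sqrt_plantedMean_sub_le (a c) (ha0 c) (ha1 c) z) (hB0 c)
        refine h2.trans ?_
        rcases (hA0 c).eq_or_lt with h | h
        · rw [← h]; simp
        rcases (hB0 c).eq_or_lt with h' | h'
        · rw [← h']; simp
        have h3 : Real.log (subcubeMean (a c) z * subcubeMean (b c) (fun j => !z j))
            ≤ Real.log (subcubeMean (a c) z) :=
          Real.log_le_log (by positivity) (mul_le_of_le_one_right h.le (hB1 c))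
        have h4 := mul_le_mul_of_nonneg_left h3 (mul_pos h h').le
        nlinarith
    _ ≤ _ := by rw [← mul_sum]; linarith

/-- The summand at `i` does not see the uniform bit `z i`, so conditioning on that bit costs exactly
a factor two. -/
theorem expect_sum_mask (Q : ι → (ι → Bool) → ℝ) (d : Bool)
    (hQ : ∀ i z c, Q i (update z i c) = Q i z) :
    𝔼 z : ι → Bool, ∑ i, (if z i = d then Q i z else 0) = (𝔼 z, ∑ i, Q i z) / 2 := by
  rw [expect_sum_comm, expect_sum_comm, sum_div]
  refine sum_congr rfl fun i _ => ?_
  rw [expect_update i]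
  cases d <;> simp [hQ]

theorem expect_sum_hellinger_le {a b : Γ → (ι → Bool) → ℝ} (ha0 : ∀ c x, 0 ≤ a c x)
    (ha1 : ∀ c x, a c x ≤ 1) (hb0 : ∀ c x, 0 ≤ b c x) (hb1 : ∀ c x, b c x ≤ 1)
    (hab : ∀ x y, ∑ c, a c x * b c y = 1) :
    𝔼 z : ι → Bool, ∑ i, ∑ c, (√(plantedMean (a c) z i true) -
        √(plantedMean (a c) z i false)) ^ 2 * plantedMean (b c) (fun j => !z j) i false
      ≤ 8 * Real.log (Fintype.card Γ) := by
  have h := expect_sum_mask (fun i z => ∑ c, (√(plantedMean (a c) z i true) -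
    √(plantedMean (a c) z i false)) ^ 2 * plantedMean (b c) (fun j => !z j) i false) true
    (fun i z c => by simp only [plantedMean_update, plantedMean_not_update])
  have h2 : 𝔼 z : ι → Bool, ∑ i, (if z i = true then ∑ c, (√(plantedMean (a c) z i true) -
        √(plantedMean (a c) z i false)) ^ 2 * plantedMean (b c) (fun j => !z j) i false else 0)
        ≤ 4 * Real.log (Fintype.card Γ) :=
    expect_le univ_nonempty fun z _ => sum_hellinger_le_of_mask ha0 ha1 hb0 hb1 hab z
  linarith

/-- The squared Hellinger distance between the planted `(1,1)` and `(0,0)` distributions is at most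
twice the sum of those obtained by changing one input only. -/
theorem cut_and_paste {A B : Bool → Γ → ℝ} (hA : ∀ p c, 0 ≤ A p c) (hB : ∀ p c, 0 ≤ B p c)
    (h : ∀ p q, ∑ c, A p c * B q c = 1) :
    ∑ c, (√(A true c) * √(B true c) - √(A false c) * √(B false c)) ^ 2 ≤
      2 * ∑ c, (√(A true c) - √(A false c)) ^ 2 * B false c +
      2 * ∑ c, (√(B true c) - √(B false c)) ^ 2 * A false c := by
  have e1 : ∑ c, (√(A true c) * √(B true c) - √(A false c) * √(B false c)) ^ 2
      = ∑ c, (A true c * B true c + A false c * B false c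
        - 2 * (√(A true c) * √(B true c) * √(A false c) * √(B false c))) := by
    refine sum_congr rfl fun c _ => ?_
    rw [sub_sq, mul_pow, mul_pow, Real.sq_sqrt (hA _ _), Real.sq_sqrt (hA _ _),
      Real.sq_sqrt (hB _ _), Real.sq_sqrt (hB _ _)]
    ring
  have e2 : ∑ c, (√(A true c) * √(B false c) - √(A false c) * √(B true c)) ^ 2
      = ∑ c, (A true c * B false c + A false c * B true c
        - 2 * (√(A true c) * √(B true c) * √(A false c) * √(B false c))) := by
    refine sum_congr rfl fun c _ => ?_
    rw [sub_sq, mul_pow, mul_pow, Real.sq_sqrt (hA _ _), Real.sq_sqrt (hA _ _),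
      Real.sq_sqrt (hB _ _), Real.sq_sqrt (hB _ _)]
    ring
  -- Both sums equal two minus twice the same sum of products of four roots: the product form lets
  -- the two players' inputs be exchanged.
  have e3 : ∑ c, (√(A true c) * √(B true c) - √(A false c) * √(B false c)) ^ 2
      = ∑ c, (√(A true c) * √(B false c) - √(A false c) * √(B true c)) ^ 2 := by
    rw [e1, e2]
    simp only [sum_sub_distrib, sum_add_distrib, h]
  rw [e3, mul_sum, mul_sum, ← sum_add_distrib]
  refine sum_le_sum fun c _ => ?_
  have hB2 := Real.sq_sqrt (hB false c)
  have hA2 := Real.sq_sqrt (hA false c)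
  calc _ ≤ 2 * ((√(A true c) - √(A false c)) ^ 2 * √(B false c) ^ 2) +
        2 * ((√(B true c) - √(B false c)) ^ 2 * √(A false c) ^ 2) := by
        nlinarith [sq_nonneg ((√(A true c) - √(A false c)) * √(B false c) +
          (√(B true c) - √(B false c)) * √(A false c))]
    _ = _ := by rw [hB2, hA2]

/-- Total variation against Hellinger distance: `|p - q| = |√p - √q| * (√p + √q)`, split by the
weighted AM-GM inequality with parameter `t`. -/
theorem sum_sub_le_hellinger {p q : Γ → ℝ} (hp : ∀ c, 0 ≤ p c) (hq : ∀ c, 0 ≤ q c)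
    (hp1 : ∑ c, p c = 1) (hq1 : ∑ c, q c = 1) (s : Finset Γ) {t : ℝ} (ht : 0 < t) :
    ∑ c ∈ s, (p c - q c) ≤ (∑ c, (√(p c) - √(q c)) ^ 2) / (2 * t) + 2 * t := by
  have key : ∀ c, |p c - q c| ≤ (√(p c) - √(q c)) ^ 2 / (2 * t) + t * (p c + q c) := by
    intro c
    obtain ⟨x, hx, hpx⟩ : ∃ x, 0 ≤ x ∧ p c = x ^ 2 := ⟨√(p c), by positivity, (Real.sq_sqrt (hp c)).symm⟩
    obtain ⟨y, hy, hqy⟩ : ∃ x, 0 ≤ x ∧ q c = x ^ 2 := ⟨√(q c), by positivity, (Real.sq_sqrt (hq c)).symm⟩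
    rw [hpx, hqy, Real.sqrt_sq hx, Real.sqrt_sq hy]
    have h1 : x ^ 2 - y ^ 2 = (x - y) * (x + y) := by ring
    rw [h1, abs_mul, abs_of_nonneg (add_nonneg hx hy), ← sq_abs (x - y),
      div_add' _ _ _ (by positivity), le_div_iff₀ (by positivity)]
    nlinarith [sq_nonneg (|x - y| - t * (x + y)), mul_nonneg (sq_nonneg t) (sq_nonneg (x - y))]
  calc _ ≤ ∑ c ∈ s, |p c - q c| := sum_le_sum fun c _ => le_abs_self _
    _ ≤ ∑ c, |p c - q c| := sum_le_univ_sum_of_nonneg fun c => abs_nonneg _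
    _ ≤ ∑ c, ((√(p c) - √(q c)) ^ 2 / (2 * t) + t * (p c + q c)) := sum_le_sum fun c _ => key c
    _ = _ := by
      rw [sum_add_distrib, ← mul_sum, sum_add_distrib, hp1, hq1, sum_div]; ring

/-- A partition into `|Γ|` rectangles hardly distinguishes a planted common element from
disjoint sets. -/
theorem disjointness_advantage_le {a b : Γ → (ι → Bool) → ℝ} (ha0 : ∀ c x, 0 ≤ a c x)
    (ha1 : ∀ c x, a c x ≤ 1) (hb0 : ∀ c x, 0 ≤ b c x) (hb1 : ∀ c x, b c x ≤ 1)
    (hab : ∀ x y, ∑ c, a c x * b c y = 1) (s : Finset Γ) {t : ℝ} (ht : 0 < t) :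
    𝔼 z : ι → Bool, ∑ i, ∑ c ∈ s,
      (plantedMean (a c) z i true * plantedMean (b c) (fun j => !z j) i true -
        plantedMean (a c) z i false * plantedMean (b c) (fun j => !z j) i false)
      ≤ 16 * Real.log (Fintype.card Γ) / t + 2 * t * Fintype.card ι := by
  have hA := expect_sum_hellinger_le ha0 ha1 hb0 hb1 hab
  have hB := expect_sum_hellinger_le hb0 hb1 ha0 ha1
    (fun x y => by simp_rw [mul_comm (b _ x)]; exact hab y x)
  have hB' : 𝔼 z : ι → Bool, ∑ i, ∑ c, (√(plantedMean (b c) (fun j => !z j) i true) -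
        √(plantedMean (b c) (fun j => !z j) i false)) ^ 2 * plantedMean (a c) z i false
      ≤ 8 * Real.log (Fintype.card Γ) := by
    refine le_trans (le_of_eq ?_) hB
    -- Complementing the mask preserves the uniform distribution and swaps the players.
    have hinv : Function.Involutive (fun z : ι → Bool => fun j => !z j) := by
      intro u; funext j; simp
    refine Fintype.expect_equiv hinv.toPerm _ _ (fun z => ?_)
    simp [Function.Involutive.coe_toPerm]
  set HA : (ι → Bool) → ι → ℝ := fun z i => ∑ c, (√(plantedMean (a c) z i true) -
        √(plantedMean (a c) z i false)) ^ 2 * plantedMean (b c) (fun j => !z j) i false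
  set HB : (ι → Bool) → ι → ℝ := fun z i => ∑ c, (√(plantedMean (b c) (fun j => !z j) i true) -
        √(plantedMean (b c) (fun j => !z j) i false)) ^ 2 * plantedMean (a c) z i false
  change 𝔼 z, ∑ i, HA z i ≤ _ at hA
  change 𝔼 z, ∑ i, HB z i ≤ _ at hB'
  have key : ∀ z i, ∑ c ∈ s,
      (plantedMean (a c) z i true * plantedMean (b c) (fun j => !z j) i true -
        plantedMean (a c) z i false * plantedMean (b c) (fun j => !z j) i false)
      ≤ (1 / t) * HA z i + (1 / t) * HB z i + 2 * t := by
    intro z i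
    have n1 : ∀ p c, 0 ≤ plantedMean (a c) z i p := fun p c => plantedMean_nonneg (ha0 c) _ _ _
    have n2 : ∀ p c, 0 ≤ plantedMean (b c) (fun j => !z j) i p :=
      fun p c => plantedMean_nonneg (hb0 c) _ _ _
    have h1 := sum_sub_le_hellinger (fun c => mul_nonneg (n1 true c) (n2 true c))
      (fun c => mul_nonneg (n1 false c) (n2 false c))
      (plantedMean_mul_plantedMean_sum hab z (fun j => !z j) i true true)
      (plantedMean_mul_plantedMean_sum hab z (fun j => !z j) i false false) s ht
    have h2 := cut_and_paste (A := fun p c => plantedMean (a c) z i p)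
      (B := fun p c => plantedMean (b c) (fun j => !z j) i p) n1 n2
      (fun p q => plantedMean_mul_plantedMean_sum hab z (fun j => !z j) i p q)
    simp_rw [Real.sqrt_mul (n1 _ _)] at h1
    refine h1.trans ?_
    have h3 := div_le_div_of_nonneg_right h2 (by positivity : 0 ≤ 2 * t)
    calc _ ≤ (2 * HA z i + 2 * HB z i) / (2 * t) + 2 * t := by
          gcongr
      _ = _ := by field_simp
  calc _ ≤ 𝔼 z : ι → Bool, ∑ i, ((1 / t) * HA z i + (1 / t) * HB z i + 2 * t) :=
        expect_le_expect fun z _ => sum_le_sum fun i _ => key z i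
    _ = (1 / t) * 𝔼 z, ∑ i, HA z i + (1 / t) * 𝔼 z, ∑ i, HB z i + 2 * t * Fintype.card ι := by
        simp only [sum_add_distrib, expect_add_distrib, ← mul_sum, ← mul_expect]
        simp; ring
    _ ≤ (1 / t) * (8 * Real.log (Fintype.card Γ)) + (1 / t) * (8 * Real.log (Fintype.card Γ))
        + 2 * t * Fintype.card ι := by gcongr
    _ = _ := by ring

end Disjointness

end Congest

namespace Congest

/-! ### Disjointness for randomized rectangle partitions. -/

section RandomizedDisjointness

open Finset Function MeasureTheory
open scoped BigOperators Classical

variable {ι : Type*} [Fintype ι] {Γ : Type*} [Fintype Γ]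

/-- The set `z ∩ u` with the membership of `i` reset to `c`. -/
noncomputable def planted (z u : ι → Bool) (i : ι) (c : Bool) : ι → Bool :=
  update (fun j => z j && u j) i c

/-- The hypothesis on `τ` makes each fibre a rectangle, so its indicator is the product of the
indicators of its two projections. -/
theorem rectangle_partition_advantage_le (τ : (ι → Bool) → (ι → Bool) → Γ)
    (hτ : ∀ x y x' y', τ x y = τ x' y' → τ x y' = τ x y) (s : Finset Γ) {t : ℝ} (ht : 0 < t) :
    𝔼 z : ι → Bool, 𝔼 u : ι → Bool, 𝔼 v : ι → Bool, ∑ i,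
      ((if τ (planted z u i true) (planted (fun j => !z j) v i true) ∈ s then (1 : ℝ) else 0) -
        (if τ (planted z u i false) (planted (fun j => !z j) v i false) ∈ s then (1 : ℝ) else 0))
      ≤ 16 * Real.log (Fintype.card Γ) / t + 2 * t * Fintype.card ι := by
  set a : Γ → (ι → Bool) → ℝ := fun c x => if ∃ y, τ x y = c then 1 else 0 with ha
  set b : Γ → (ι → Bool) → ℝ := fun c y => if ∃ x, τ x y = c then 1 else 0 with hb
  have hab : ∀ c x y, a c x * b c y = if τ x y = c then 1 else 0 := by
    intro c x y
    have : τ x y = c ↔ (∃ y, τ x y = c) ∧ ∃ x, τ x y = c := by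
      constructor
      · intro h; exact ⟨⟨y, h⟩, ⟨x, h⟩⟩
      · rintro ⟨⟨y', h1⟩, ⟨x', h2⟩⟩
        rw [hτ x y' x' y (h1.trans h2.symm), h1]
    simp only [ha, hb]
    by_cases h1 : ∃ y, τ x y = c <;> by_cases h2 : ∃ x, τ x y = c <;> simp [this, h1, h2]
  have hsum : ∀ x y, (if τ x y ∈ s then (1 : ℝ) else 0) = ∑ c ∈ s, a c x * b c y := by
    intro x y; simp [hab]
  have h0 : ∀ c x, 0 ≤ a c x ∧ a c x ≤ 1 := by
    intro c x; simp only [ha]; split_ifs <;> norm_num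
  have h1 : ∀ c x, 0 ≤ b c x ∧ b c x ≤ 1 := by
    intro c x; simp only [hb]; split_ifs <;> norm_num
  refine le_trans (le_of_eq ?_) (disjointness_advantage_le (fun c x => (h0 c x).1)
    (fun c x => (h0 c x).2) (fun c x => (h1 c x).1) (fun c x => (h1 c x).2)
    (fun x y => by simp [hab]) s ht)
  refine expect_congr rfl fun z _ => ?_
  simp_rw [hsum, ← sum_sub_distrib, expect_sum_comm, expect_sub_distrib, ← expect_mul_expect]
  rfl

theorem expect_eq_weighted_sum (f : (ι → Bool) → (ι → Bool) → (ι → Bool) → ℝ) :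
    𝔼 z, 𝔼 u, 𝔼 v, f z u v = ((Fintype.card (ι → Bool) : ℝ)⁻¹) ^ 3 *
      ∑ p : (ι → Bool) × (ι → Bool) × (ι → Bool), f p.1 p.2.1 p.2.2 := by
  simp_rw [Fintype.expect_eq_sum_div_card, Fintype.sum_prod_type, ← sum_div]
  field_simp

/-- A lower bound for the randomized communication complexity of set disjointness, for any error
probability below `1/2`. -/
theorem randomized_disjointness {Ω : Type*} [MeasurableSpace Ω] (μ : Measure Ω)
    [IsProbabilityMeasure μ] {ε : ℝ} (good : (ι → Bool) → (ι → Bool) → Set Ω)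
    (hmeas : ∀ x y, MeasurableSet (good x y)) (hprob : ∀ x y, 1 - ε ≤ μ.real (good x y))
    (τ : Ω → (ι → Bool) → (ι → Bool) → Γ)
    (hτ : ∀ ω x y x' y', τ ω x y = τ ω x' y' → τ ω x y' = τ ω x y) (s : Finset Γ)
    (hgood : ∀ ω x y, ω ∈ good x y → (τ ω x y ∈ s ↔ ∃ i, x i = true ∧ y i = true))
    {t : ℝ} (ht : 0 < t) :
    (1 - 2 * ε) * Fintype.card ι ≤
      16 * Real.log (Fintype.card Γ) / t + 2 * t * Fintype.card ι := by
  set S : Bool → (ι → Bool) → (ι → Bool) → (ι → Bool) → ι → Set Ω :=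
    fun c z u v i => good (planted z u i c) (planted (fun j => !z j) v i c) with hS
  set B := 16 * Real.log (Fintype.card Γ) / t + 2 * t * Fintype.card ι
  set w : ℝ := ((Fintype.card (ι → Bool) : ℝ)⁻¹) ^ 3 with hw
  have hw0 : 0 ≤ w := by positivity
  -- For fixed coins, being right on both planted inputs forces them to be told apart, so right
  -- answers number at most one plus the advantage. Integrating over the coins gives `2 * (1 - ε) *
  -- k ≤ k + B` with `k` elements.
  have hpt : ∀ ω, w * ∑ p : (ι → Bool) × (ι → Bool) × (ι → Bool), ∑ i,
      ((S true p.1 p.2.1 p.2.2 i).indicator (fun _ => (1 : ℝ)) ω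
        + (S false p.1 p.2.1 p.2.2 i).indicator (fun _ => (1 : ℝ)) ω) ≤ Fintype.card ι + B := by
    intro ω
    have h1 := rectangle_partition_advantage_le (τ ω) (hτ ω) s ht
    have h2 : ∀ z u v i, (S true z u v i).indicator (fun _ => (1 : ℝ)) ω
        + (S false z u v i).indicator (fun _ => (1 : ℝ)) ω ≤ 1 +
        ((if τ ω (planted z u i true) (planted (fun j => !z j) v i true) ∈ s then (1 : ℝ) else 0) -
        (if τ ω (planted z u i false) (planted (fun j => !z j) v i false) ∈ s
          then (1 : ℝ) else 0)) := by
      intro z u v i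
      have e1 : (S true z u v i).indicator (fun _ => (1 : ℝ)) ω ≤
          (if τ ω (planted z u i true) (planted (fun j => !z j) v i true) ∈ s
            then (1 : ℝ) else 0) := by
        by_cases h : ω ∈ S true z u v i
        · rw [Set.indicator_of_mem h, if_pos ((hgood _ _ _ h).2 ⟨i, by simp [planted]⟩)]
        · rw [Set.indicator_of_notMem h]; split_ifs <;> norm_num
      have e2 : (S false z u v i).indicator (fun _ => (1 : ℝ)) ω ≤ 1 -
          (if τ ω (planted z u i false) (planted (fun j => !z j) v i false) ∈ s
            then (1 : ℝ) else 0) := by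
        by_cases h : ω ∈ S false z u v i
        · rw [Set.indicator_of_mem h, if_neg]
          · norm_num
          rw [hgood _ _ _ h]
          -- Away from `i` the sets lie in complementary masks, so they cannot meet.
          rintro ⟨j, hj1, hj2⟩
          by_cases hji : j = i
          · subst hji; simp [planted] at hj1
          · simp [planted, hji] at hj1 hj2
            simp [hj1.1] at hj2
        · rw [Set.indicator_of_notMem h]; split_ifs <;> norm_num
      linarith
    rw [← expect_eq_weighted_sum (fun z u v => ∑ i,
      ((S true z u v i).indicator (fun _ => (1 : ℝ)) ω
        + (S false z u v i).indicator (fun _ => (1 : ℝ)) ω))]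
    calc _ ≤ 𝔼 z : ι → Bool, 𝔼 u : ι → Bool, 𝔼 v : ι → Bool, ∑ i, (1 +
        ((if τ ω (planted z u i true) (planted (fun j => !z j) v i true) ∈ s then (1 : ℝ) else 0) -
        (if τ ω (planted z u i false) (planted (fun j => !z j) v i false) ∈ s
          then (1 : ℝ) else 0))) :=
          expect_le_expect fun z _ => expect_le_expect fun u _ => expect_le_expect fun v _ =>
            sum_le_sum fun i _ => h2 z u v i
      _ ≤ _ := by
        simp_rw [sum_add_distrib, expect_add_distrib]
        refine add_le_add (le_of_eq ?_) h1
        simp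
  have hint : ∀ A : Set Ω, MeasurableSet A → Integrable (A.indicator (fun _ => (1 : ℝ))) μ :=
    fun A hA => (integrable_const 1).indicator hA
  have hval : ∀ A : Set Ω, MeasurableSet A →
      ∫ ω, A.indicator (fun _ => (1 : ℝ)) ω ∂μ = μ.real A := by
    intro A hA
    rw [integral_indicator_const _ hA]; simp
  have hI : ∫ ω, w * ∑ p : (ι → Bool) × (ι → Bool) × (ι → Bool), ∑ i,
      ((S true p.1 p.2.1 p.2.2 i).indicator (fun _ => (1 : ℝ)) ω
        + (S false p.1 p.2.1 p.2.2 i).indicator (fun _ => (1 : ℝ)) ω) ∂μ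
      = w * ∑ p : (ι → Bool) × (ι → Bool) × (ι → Bool), ∑ i,
      (μ.real (S true p.1 p.2.1 p.2.2 i) + μ.real (S false p.1 p.2.1 p.2.2 i)) := by
    rw [integral_const_mul, integral_finsetSum]
    · congr 1
      refine sum_congr rfl fun p _ => ?_
      rw [integral_finsetSum]
      · refine sum_congr rfl fun i _ => ?_
        rw [integral_add (hint _ (hmeas _ _)) (hint _ (hmeas _ _)), hval _ (hmeas _ _),
          hval _ (hmeas _ _)]
      · exact fun i _ => (hint _ (hmeas _ _)).add (hint _ (hmeas _ _))
    · exact fun p _ => integrable_finsetSum _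
        fun i _ => (hint _ (hmeas _ _)).add (hint _ (hmeas _ _))
  have hup := integral_mono (μ := μ) (Integrable.const_mul (integrable_finsetSum _
    fun p _ => integrable_finsetSum _
        fun i _ => (hint _ (hmeas _ _)).add (hint _ (hmeas _ _))) w)
      (integrable_const ((Fintype.card ι : ℝ) + B)) hpt
  simp only [Pi.add_apply] at hup
  rw [hI] at hup
  simp only [integral_const, probReal_univ, smul_eq_mul, one_mul] at hup
  have hlow : w * ∑ p : (ι → Bool) × (ι → Bool) × (ι → Bool), ∑ i : ι,
      (2 * (1 - ε)) ≤ w * ∑ p : (ι → Bool) × (ι → Bool) × (ι → Bool), ∑ i,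
      (μ.real (S true p.1 p.2.1 p.2.2 i) + μ.real (S false p.1 p.2.1 p.2.2 i)) := by
    refine mul_le_mul_of_nonneg_left (sum_le_sum fun p _ => sum_le_sum fun i _ => ?_) hw0
    linarith [hprob (planted p.1 p.2.1 i true) (planted (fun j => !p.1 j) p.2.2 i true),
      hprob (planted p.1 p.2.1 i false) (planted (fun j => !p.1 j) p.2.2 i false)]
  rw [← expect_eq_weighted_sum (fun _ _ _ => ∑ i : ι, (2 * (1 - ε)))] at hlow
  simp at hlow
  linarith

end RandomizedDisjointness

end Congest

namespace Congest

/-! ### From protocols to rectangle partitions across a cut. -/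

section Simulation

open MeasureTheory

/-- Two-party simulation: `S` is the part of the network held by the first player, whose inputs
affect only edges at nodes of `S`; the pairs `(p c, q c)` contain all edges that leave `S`. -/
structure IsCut {X Y κ : Type*} {n : ℕ} (G : X → Y → SimpleGraph (Fin n)) (S : Set (Fin n))
    (p q : κ → Fin n) : Prop where
  adj_left : ∀ a ∈ S, ∀ x y y' w, (G x y).Adj a w → (G x y').Adj a w
  adj_right : ∀ a ∉ S, ∀ x x' y w, (G x y).Adj a w → (G x' y).Adj a w
  crossing : ∀ a ∈ S, ∀ w ∉ S, ∀ x y, (G x y).Adj a w → ∃ c, a = p c ∧ w = q c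

variable {Coins : Type u} {n b : ℕ} {X Y κ : Type*}

/-- The messages sent over the pairs `(p c, q c)` during the first `T` rounds. -/
noncomputable def transcript (P : Protocol.{u, v} Coins n b) (G : X → Y → SimpleGraph (Fin n))
    (p q : κ → Fin n) (T : ℕ) (ω : Coins) (x : X) (y : Y) :
    Fin T → κ → Message b × Message b := fun t c =>
  (P.send (P.stateAfter (G x y) ω t (p c)) (q c), P.send (P.stateAfter (G x y) ω t (q c)) (p c))

/-- Induction on rounds: a side hears from the other only over the pairs `(p c, q c)`, where the two
runs carry the same messages. So a node's state depends only on its own side's input and the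
transcript. -/
theorem stateAfter_of_transcript_eq (P : Protocol.{u, v} Coins n b)
    {G : X → Y → SimpleGraph (Fin n)} {S : Set (Fin n)} {p q : κ → Fin n} (hG : IsCut G S p q)
    (T : ℕ) (ω : Coins) {x x' : X} {y y' : Y}
    (h : transcript P G p q T ω x y = transcript P G p q T ω x' y') (t : ℕ) (ht : t ≤ T) :
    (∀ a ∈ S, P.stateAfter (G x y') ω t a = P.stateAfter (G x y) ω t a) ∧
      ∀ a ∉ S, P.stateAfter (G x y') ω t a = P.stateAfter (G x' y') ω t a := by
  have hl : ∀ a ∈ S, ∀ w, (G x y').Adj a w ↔ (G x y).Adj a w := fun a ha w =>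
    ⟨hG.adj_left a ha x y' y w, hG.adj_left a ha x y y' w⟩
  have hr : ∀ a ∉ S, ∀ w, (G x y').Adj a w ↔ (G x' y').Adj a w := fun a ha w =>
    ⟨hG.adj_right a ha x x' y' w, hG.adj_right a ha x' x y' w⟩
  induction t with
  | zero =>
    constructor
    · intro a ha
      have : (G x y').neighborSet a = (G x y).neighborSet a := by ext w; exact hl a ha w
      simp only [Protocol.stateAfter, this]
    · intro a ha
      have : (G x y').neighborSet a = (G x' y').neighborSet a := by ext w; exact hr a ha w
      simp only [Protocol.stateAfter, this]
  | succ t ih =>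
    obtain ⟨ih1, ih2⟩ := ih (by omega)
    have hmsg := fun c => congrFun (congrFun h ⟨t, by omega⟩) c
    simp only [transcript, Prod.mk.injEq] at hmsg
    constructor
    · intro a ha
      simp only [Protocol.stateAfter]
      rw [ih1 a ha]
      congr 1
      funext w
      by_cases hw : (G x y).Adj a w
      · rw [if_pos ((hl a ha w).2 hw), if_pos hw]
        by_cases hwS : w ∈ S
        · rw [ih1 w hwS]
        · obtain ⟨c, rfl, rfl⟩ := hG.crossing a ha w hwS x y hw
          rw [ih2 _ hwS, (hmsg c).2]
      · rw [if_neg (fun h' => hw ((hl a ha w).1 h')), if_neg hw]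
    · intro a ha
      simp only [Protocol.stateAfter]
      rw [ih2 a ha]
      congr 1
      funext w
      by_cases hw : (G x' y').Adj a w
      · rw [if_pos ((hr a ha w).2 hw), if_pos hw]
        by_cases hwS : w ∈ S
        · obtain ⟨c, rfl, rfl⟩ := hG.crossing w hwS a ha x' y' hw.symm
          rw [ih1 _ hwS, (hmsg c).1]
        · rw [ih2 w hwS]
      · rw [if_neg (fun h' => hw ((hr a ha w).1 h')), if_neg hw]

theorem card_message_le (b : ℕ) : Fintype.card (Message b) ≤ 2 ^ (b + 1) := by
  simp only [Message, Fintype.card_sigma, Fintype.card_fun, Fintype.card_bool, Fintype.card_fin]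
  rw [Fin.sum_univ_eq_sum_range (fun l => 2 ^ l)]
  exact (Nat.geomSum_lt le_rfl (fun k hk => Finset.mem_range.1 hk)).le

open scoped Classical in
/-- The transcript, with a bit for each player that tells whether one of its nodes outputs `r`. -/
noncomputable def labelledTranscript (P : Protocol.{u, v} Coins n b)
    (G : X → Y → SimpleGraph (Fin n)) (S : Set (Fin n)) (p q : κ → Fin n) (T r : ℕ) (ω : Coins)
    (x : X) (y : Y) : (Fin T → κ → Message b × Message b) × Bool × Bool :=
  (transcript P G p q T ω x y,
    decide (∃ a ∈ S, P.output (P.stateAfter (G x y) ω T a) = some r),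
    decide (∃ a, a ∉ S ∧ P.output (P.stateAfter (G x y) ω T a) = some r))

theorem labelledTranscript_rectangle (P : Protocol.{u, v} Coins n b)
    {G : X → Y → SimpleGraph (Fin n)} {S : Set (Fin n)} {p q : κ → Fin n} (hG : IsCut G S p q)
    (T r : ℕ) (ω : Coins) (x : X) (y : Y) (x' : X) (y' : Y)
    (h : labelledTranscript P G S p q T r ω x y = labelledTranscript P G S p q T r ω x' y') :
    labelledTranscript P G S p q T r ω x y' = labelledTranscript P G S p q T r ω x y := by
  simp only [labelledTranscript, Prod.mk.injEq, decide_eq_decide] at h ⊢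
  obtain ⟨h1, h2, h3⟩ := h
  have key := stateAfter_of_transcript_eq P hG T ω h1
  refine ⟨?_, ?_, ?_⟩
  · funext t c
    have ht := key t t.2.le
    have hm := congrFun (congrFun h1 t) c
    -- The side of `a` is left open because `p c` and `q c` are not assumed to lie on given sides.
    have hside : ∀ a w, (P.send (P.stateAfter (G x y) ω t a) w
        = P.send (P.stateAfter (G x' y') ω t a) w) →
        P.send (P.stateAfter (G x y') ω t a) w = P.send (P.stateAfter (G x y) ω t a) w := by
      intro a w haw
      by_cases ha : a ∈ S
      · rw [ht.1 a ha]
      · rw [ht.2 a ha, haw]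
    simp only [transcript, Prod.mk.injEq] at hm ⊢
    exact ⟨hside _ _ hm.1, hside _ _ hm.2⟩
  · refine exists_congr fun a => and_congr_right fun ha => ?_
    rw [(key T le_rfl).1 a ha]
  · rw [h3]
    refine exists_congr fun a => and_congr_right fun ha => ?_
    rw [(key T le_rfl).2 a ha]

theorem log_card_labelledTranscript_le (b T : ℕ) (κ : Type*) [Fintype κ] [DecidableEq κ] :
    Real.log (Fintype.card ((Fin T → κ → Message b × Message b) × Bool × Bool)) ≤
      2 * (b + 1) * T * Fintype.card κ + 2 := by
  have h1 : Fintype.card ((Fin T → κ → Message b × Message b) × Bool × Bool) ≤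
      2 ^ (2 * (b + 1) * T * Fintype.card κ + 2) := by
    simp only [Fintype.card_prod, Fintype.card_fun, Fintype.card_bool, Fintype.card_fin]
    calc _ ≤ ((2 ^ (b + 1) * 2 ^ (b + 1)) ^ Fintype.card κ) ^ T * (2 * 2) := by
          gcongr <;> exact card_message_le b
      _ = _ := by rw [← pow_add, ← pow_mul, ← pow_mul, pow_add]; congr 2; ring
  have hpos : 0 < Fintype.card ((Fin T → κ → Message b × Message b) × Bool × Bool) :=
    Fintype.card_pos_iff.2 ⟨(fun _ _ => (⟨0, fun _ => false⟩, ⟨0, fun _ => false⟩), false, false)⟩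
  have h2 : Real.log (Fintype.card ((Fin T → κ → Message b × Message b) × Bool × Bool)) ≤
      Real.log ((2 : ℝ) ^ (2 * (b + 1) * T * Fintype.card κ + 2)) :=
    Real.log_le_log (by exact_mod_cast hpos) (by exact_mod_cast h1)
  rw [Real.log_pow] at h2
  push_cast at h2
  have h3 : Real.log 2 ≤ 1 := by linarith [Real.log_two_lt_d9]
  refine h2.trans (mul_le_of_le_one_right (by positivity) h3)

/-- A family of networks that encodes set disjointness of `k`-element universes into the radius
across a cut forces `T` times the size of the cut times the message length to be of order `k`. -/
theorem rounds_lower_bound_of_isCut [MeasurableSpace Coins] (μ : Measure Coins)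
    [IsProbabilityMeasure μ] {ι : Type*} [Fintype ι] [Fintype κ] (P : Protocol.{u, v} Coins n b)
    {G : (ι → Bool) → (ι → Bool) → SimpleGraph (Fin n)} {S : Set (Fin n)} {p q : κ → Fin n}
    (hG : IsCut G S p q) (hnet : ∀ x y, IsNetworkOfMaxDegreeFive (G x y)) (r : ℕ)
    (hr : ∀ x y, (G x y).radius = r ↔ ∃ i, x i = true ∧ y i = true) {ε : ℝ} {T : ℕ}
    (hP : P.ComputesRadiusWithin μ ε T) {t : ℝ} (ht : 0 < t) :
    (1 - 2 * ε) * Fintype.card ι ≤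
      16 * (2 * (b + 1) * T * Fintype.card κ + 2) / t + 2 * t * Fintype.card ι := by
  classical
  have h := randomized_disjointness μ (fun x y => {ω | P.OutputsRadius (G x y) T ω})
    (fun x y => (hP _ (hnet x y)).1) (fun x y => (hP _ (hnet x y)).2)
    (fun ω x y => labelledTranscript P G S p q T r ω x y)
    (fun ω x y x' y' => labelledTranscript_rectangle P hG T r ω x y x' y')
    {c | c.2.1 = true ∨ c.2.2 = true} ?_ ht
  · refine h.trans ?_
    have := log_card_labelledTranscript_le b T κ
    gcongr
  · intro ω x y hω
    rw [← hr x y]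
    have e : labelledTranscript P G S p q T r ω x y ∈
        ({c | c.2.1 = true ∨ c.2.2 = true} :
          Finset ((Fin T → κ → Message b × Message b) × Bool × Bool)) ↔
        ∃ a, P.output (P.stateAfter (G x y) ω T a) = some r := by
      simp only [labelledTranscript, Finset.mem_filter, Finset.mem_univ, true_and,
        decide_eq_true_eq]
      constructor
      · rintro (⟨a, -, h⟩ | ⟨a, -, h⟩) <;> exact ⟨a, h⟩
      · rintro ⟨a, h⟩
        by_cases ha : a ∈ S
        · exact Or.inl ⟨a, ha, h⟩
        · exact Or.inr ⟨a, ha, h⟩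
    rw [e]
    -- In a correct run some node outputs, and only the radius is ever output; hence `r` is output
    -- exactly when it is the radius.
    obtain ⟨⟨a, ha⟩, hout⟩ := hω
    constructor
    · rintro ⟨a, h⟩; exact hout a r h
    · intro h
      obtain ⟨r', hr'⟩ := Option.ne_none_iff_exists'.1 ha
      have := hout a r' hr'
      rw [h] at this
      have : r = r' := by exact_mod_cast this
      exact ⟨a, by rw [hr', this]⟩

end Simulation

end Congest

/-! ### The network and lower bounds on its distances. -/

namespace Congest

theorem size_half_add_one {m : ℕ} (hm : m ≠ 0) : (m / 2).size + 1 = m.size := by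
  have h : ∀ k, m.size ≤ k + 1 ↔ (m / 2).size ≤ k := by
    intro k; rw [Nat.size_le, Nat.size_le, pow_succ]; omega
  have h1 := (h (m / 2).size).2 le_rfl
  have h2 : 0 < m.size := Nat.size_pos.2 (Nat.pos_of_ne_zero hm)
  have h3 := (h (m.size - 1)).1 (by omega)
  omega

theorem size_two_pow_add {L i : ℕ} (hi : i < 2 ^ L) : (2 ^ L + i).size = L + 1 := by
  have h1 : (2 ^ L + i).size ≤ L + 1 := Nat.size_le.2 (by rw [pow_succ]; omega)
  have h2 : L < (2 ^ L + i).size := Nat.lt_size.2 (by omega)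
  omega

/-- The nodes of the lower bound networks. Each index `i < 2 ^ L` has a line of nodes `alice i h`
and a line `bob i p`. For each bit position `h` and bit value `c` both players have a binary tree
in heap order above the indices. The first player has a further tree `sel`, from whose root hang a
path and a padding tree. -/
inductive Node : Type
  | alice (i h : ℕ)
  | tree (side : Bool) (h : ℕ) (c : Bool) (m : ℕ)
  | bob (i p : ℕ)
  | sel (m : ℕ)
  | path (k : ℕ)
  | pad (k : ℕ)

namespace Node

/-- The nodes of the network with `2 ^ L` indices and `q` padding nodes. -/
def Valid (L q : ℕ) : Node → Prop
  | alice i h => i < 2 ^ L ∧ h ≤ L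
  | tree _ h _ m => h ≤ L ∧ m < 2 ^ (L + 1)
  | bob i p => i < 2 ^ L ∧ p ≤ 4 * L + 4
  | sel m => m < 2 ^ (L + 1)
  | path k => k ≤ 5 * L + 6
  | pad k => k < q

/-- The nodes held by the first player. -/
def IsLeft : Node → Prop
  | alice _ _ => True
  | tree s _ _ _ => s = true
  | bob _ _ => False
  | sel _ => True
  | path _ => True
  | pad _ => True

/-- The links of the network, where `x` and `y` are the inputs of the players. -/
inductive Link (L : ℕ) (x y : ℕ → Bool) : Node → Node → Prop
  | alice_line (i h : ℕ) : Link L x y (alice i h) (alice i (h + 1))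
  | alice_leaf (i h : ℕ) : Link L x y (alice i h) (tree true h (i.testBit h) (2 ^ L + i))
  | heap (s : Bool) (h : ℕ) (c : Bool) (m : ℕ) : Link L x y (tree s h c m) (tree s h c (m / 2))
  | cut (h : ℕ) (c : Bool) : Link L x y (tree true h c 0) (tree false h c 0)
  | bob_leaf (i h : ℕ) : Link L x y (bob i h) (tree false h (!i.testBit h) (2 ^ L + i))
  | bob_input (i : ℕ) (hy : y i = true) : Link L x y (bob i L) (tree false L false (2 ^ L + i))
  | bob_line (i p : ℕ) : Link L x y (bob i p) (bob i (p + 1))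
  | sel_heap (m : ℕ) : Link L x y (sel m) (sel (m / 2))
  | alice_input (i : ℕ) (hx : x i = true) : Link L x y (alice i 0) (sel (2 ^ L + i))
  | path_root : Link L x y (path 0) (sel 0)
  | path_line (k : ℕ) : Link L x y (path k) (path (k + 1))
  | pad_root : Link L x y (pad 0) (sel 0)
  | pad_heap (k : ℕ) : Link L x y (pad k) (pad (k / 4))

end Node

open Node

/-- The lower bound network, with isolated nodes outside of `Node.Valid L q`. -/
def nodeGraph (L q : ℕ) (x y : ℕ → Bool) : SimpleGraph Node where
  Adj a b := a ≠ b ∧ a.Valid L q ∧ b.Valid L q ∧ (Link L x y a b ∨ Link L x y b a)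
  symm := ⟨fun _ _ h => ⟨h.1.symm, h.2.2.1, h.2.1, h.2.2.2.symm⟩⟩
  loopless := ⟨fun _ h => h.1 rfl⟩

/-- There is a walk of length at most `d` from `a` to `b`. -/
def Near {V : Type*} (G : SimpleGraph V) (a b : V) (d : ℕ) : Prop :=
  ∃ w : G.Walk a b, w.length ≤ d

namespace Near

variable {V : Type*} {G : SimpleGraph V} {a b c : V} {d e : ℕ}

theorem refl (G : SimpleGraph V) (a : V) (d : ℕ) : Near G a a d := ⟨.nil, by simp⟩

theorem symm (h : Near G a b d) : Near G b a d := by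
  obtain ⟨w, hw⟩ := h; exact ⟨w.reverse, by simpa using hw⟩

theorem trans (h : Near G a b d) (h' : Near G b c e) : Near G a c (d + e) := by
  obtain ⟨w, hw⟩ := h
  obtain ⟨w', hw'⟩ := h'
  exact ⟨w.append w', by rw [SimpleGraph.Walk.length_append]; omega⟩

theorem mono (h : Near G a b d) (hde : d ≤ e) : Near G a b e := by
  obtain ⟨w, hw⟩ := h; exact ⟨w, hw.trans hde⟩

theorem of_adj (h : G.Adj a b) : Near G a b 1 := ⟨h.toWalk, by simp⟩

theorem of_line (f : ℕ → V) {l : ℕ} (h : ∀ k < l, G.Adj (f k) (f (k + 1))) {i j : ℕ} (hij : i ≤ j)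
    (hj : j ≤ l) : Near G (f i) (f j) (j - i) := by
  induction j, hij using Nat.le_induction with
  | base => exact refl _ _ _
  | succ k hk ih => exact ((ih (by omega)).trans (of_adj (h k (by omega)))).mono (by omega)

theorem of_heap (f : ℕ → V) (g : ℕ → ℕ) {l : ℕ} (hg : ∀ k, g k ≤ k / 2)
    (h : ∀ k < l, k ≠ 0 → G.Adj (f k) (f (g k))) {k : ℕ} (hk : k < l) :
    Near G (f k) (f 0) k.size := by
  induction k using Nat.strong_induction_on with
  | _ k ih =>
    rcases eq_or_ne k 0 with rfl | hk0
    · exact refl _ _ _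
    · have h1 := hg k
      have h2 := size_half_add_one hk0
      have h3 := Nat.size_le_size h1
      exact ((of_adj (h k hk hk0)).trans (ih (g k) (by omega) (by omega))).mono (by omega)

theorem le_add_of_lipschitz (f : V → ℕ) (hf : ∀ a b, G.Adj a b → f b ≤ f a + 1)
    (h : Near G a b d) : f b ≤ f a + d := by
  obtain ⟨w, hw⟩ := h
  induction w generalizing d with
  | nil => omega
  | cons hadj w ih =>
    rw [SimpleGraph.Walk.length_cons] at hw
    have h1 := hf _ _ hadj
    have h2 := ih (d := d - 1) (by omega)
    omega

end Near

section NodeGraph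

variable {L q : ℕ} {x y : ℕ → Bool}

theorem nodeGraph_lipschitz (f : Node → ℕ)
    (hf : ∀ a b, a.Valid L q → b.Valid L q → Link L x y a b → f b ≤ f a + 1 ∧ f a ≤ f b + 1)
    (a b : Node) (h : (nodeGraph L q x y).Adj a b) : f b ≤ f a + 1 := by
  obtain ⟨-, ha, hb, h | h⟩ := h
  · exact (hf a b ha hb h).1
  · exact (hf b a hb ha h).2

theorem size_le_of_lt {m : ℕ} (hm : m < 2 ^ (L + 1)) : m.size ≤ L + 1 := Nat.size_le.2 hm

theorem size_half_bounds (m : ℕ) : (m / 2).size ≤ m.size ∧ m.size ≤ (m / 2).size + 1 := by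
  rcases eq_or_ne m 0 with rfl | h
  · simp
  · have := size_half_add_one h; omega

/-- The height of a node, along which shortest walks from the first player's indices to the
second player's ascend. -/
def height (L : ℕ) : Node → ℕ
  | alice _ h => h + 1
  | tree true h _ m => h + 2 + (L + 1 - m.size)
  | tree false h _ m => h + L + 4 + m.size
  | bob _ p => p + 2 * L + 6
  | _ => 0

theorem height_lipschitz (a b : Node) (ha : a.Valid L q) (hb : b.Valid L q)
    (h : Link L x y a b) : height L b ≤ height L a + 1 ∧ height L a ≤ height L b + 1 := by
  cases h with
  | alice_line i h => simp only [height]; omega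
  | alice_leaf i h => simp only [height, size_two_pow_add ha.1]; omega
  | heap s h c m =>
    have h1 := size_half_bounds m
    have h2 := size_le_of_lt ha.2
    cases s <;> simp only [height] <;> omega
  | cut h c => simp only [height, Nat.size_zero]; omega
  | bob_leaf i h => simp only [height, size_two_pow_add ha.1]; omega
  | bob_input i hy => simp only [height, size_two_pow_add ha.1]; omega
  | bob_line i p => simp only [height]; omega
  | sel_heap m => simp only [height]; omega
  | alice_input i hx => simp only [height]; omega
  | path_root => simp only [height]; omega
  | path_line k => simp only [height]; omega
  | pad_root => simp only [height]; omega
  | pad_heap k => simp only [height]; omega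

open scoped Classical in
/-- The height, raised by one at nodes without an ascending walk from index `i` of the first
player. -/
noncomputable def shiftedHeight (L i : ℕ) (a : Node) : ℕ :=
  height L a + if (match a with
    | alice j _ => j = i
    | tree _ h c _ => c = i.testBit h
    | bob j _ => j ≠ i
    | _ => False) then 0 else 1

/-- A link between a raised and an unraised node has its lower end raised, so the shifted heights
coincide there. The input link of Bob's line `i` would be the one exception, and `y i = false`
removes it. -/
theorem shiftedHeight_lipschitz {i : ℕ} (hi : i < 2 ^ L) (hyi : y i = false) (a b : Node)
    (ha : a.Valid L q) (hb : b.Valid L q) (h : Link L x y a b) :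
    shiftedHeight L i b ≤ shiftedHeight L i a + 1 ∧
      shiftedHeight L i a ≤ shiftedHeight L i b + 1 := by
  have hh := height_lipschitz a b ha hb h
  cases h with
  | alice_line j h => simp only [shiftedHeight]; omega
  | alice_leaf j h =>
    by_cases hj : j = i
    · subst hj; simp only [shiftedHeight]; simp; omega
    · simp only [shiftedHeight, height, size_two_pow_add ha.1, if_neg hj]; split_ifs <;> omega
  | heap s h c m => simp only [shiftedHeight]; omega
  | cut h c => simp only [shiftedHeight]; omega
  | bob_leaf j h =>
    by_cases hj : j = i
    · subst hj; simp only [shiftedHeight]; simp; omega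
    · simp only [shiftedHeight, height, size_two_pow_add ha.1, ne_eq, hj, not_false_eq_true, if_true]
      split_ifs <;> omega
  | bob_input j hy =>
    have hj : j ≠ i := by rintro rfl; simp [hyi] at hy
    simp only [shiftedHeight, height, size_two_pow_add ha.1, ne_eq, hj, not_false_eq_true, if_true]
    split_ifs <;> omega
  | bob_line j p => simp only [shiftedHeight, height]; omega
  | sel_heap m => simp only [shiftedHeight, height]; omega
  | alice_input j hx => simp only [shiftedHeight, height, if_false]; split_ifs <;> omega
  | path_root => simp only [shiftedHeight, height]; omega
  | path_line k => simp only [shiftedHeight, height]; omega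
  | pad_root => simp only [shiftedHeight, height]; omega
  | pad_heap k => simp only [shiftedHeight, height]; omega

/-- A lower bound for the distance to the end of the path. -/
def pathDist (L : ℕ) (x : ℕ → Bool) : Node → ℕ
  | path k => 5 * L + 6 - k
  | sel m => 5 * L + 7 + m.size
  | pad _ => 5 * L + 7
  | alice i h => if h = 0 ∧ x i = true then 6 * L + 9 else 6 * L + 10
  | _ => 6 * L + 10

/-- The constant `6 * L + 10` caps the value at nodes away from `sel`; only an input link can lower
it by one, at `alice i 0`. A leaf of `sel` has value `6 * L + 8`. -/
theorem pathDist_lipschitz (a b : Node) (ha : a.Valid L q) (hb : b.Valid L q)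
    (h : Link L x y a b) : pathDist L x b ≤ pathDist L x a + 1 ∧
      pathDist L x a ≤ pathDist L x b + 1 := by
  cases h with
  | alice_line i h => simp only [pathDist]; split_ifs <;> omega
  | alice_leaf i h => simp only [pathDist]; split_ifs <;> omega
  | heap s h c m => simp only [pathDist]; omega
  | cut h c => simp only [pathDist]; omega
  | bob_leaf i h => simp only [pathDist]; omega
  | bob_input i hy => simp only [pathDist]; omega
  | bob_line i p => simp only [pathDist]; omega
  | sel_heap m =>
    have h1 := size_half_bounds m
    simp only [pathDist]; omega
  | alice_input i hx =>
    simp only [pathDist, size_two_pow_add ha.1, hx, and_self, if_true]; omega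
  | path_root => simp only [pathDist, Nat.size_zero]; omega
  | path_line k => simp only [pathDist]; omega
  | pad_root => simp only [pathDist, Nat.size_zero]; omega
  | pad_heap k => simp only [pathDist]; omega

/-- Only an index that belongs to the first player's set can have eccentricity at most
`6 * L + 9`, and it has no smaller one. -/
theorem exists_far_node (a : Node) :
    ∃ b : Node, b.Valid L q ∧ ∀ d, Near (nodeGraph L q x y) a b d →
      6 * L + 10 ≤ d ∨ (6 * L + 9 ≤ d ∧ ∃ i, a = alice i 0 ∧ x i = true) := by
  have hpath : ∀ d, Near (nodeGraph L q x y) a (path (5 * L + 6)) d → pathDist L x a ≤ d := by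
    intro d h
    have := h.symm.le_add_of_lipschitz _ (nodeGraph_lipschitz _ pathDist_lipschitz)
    simpa [pathDist] using this
  have hbob : ∀ d, Near (nodeGraph L q x y) a (bob 0 (4 * L + 4)) d →
      6 * L + 10 ≤ height L a + d := by
    intro d h
    have := h.le_add_of_lipschitz _ (nodeGraph_lipschitz _ height_lipschitz)
    change 4 * L + 4 + 2 * L + 6 ≤ _ at this
    omega
  have hp : (path (5 * L + 6)).Valid L q := le_rfl
  -- Any of Bob's lines would do: its end has height `6 * L + 10`, and `sel`, path and padding have
  -- height `0`.
  have hb : (bob 0 (4 * L + 4)).Valid L q := ⟨by positivity, le_rfl⟩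
  cases a with
  | alice i h =>
    refine ⟨_, hp, fun d hd => ?_⟩
    have := hpath d hd
    simp only [pathDist] at this
    split_ifs at this with hc
    · right; refine ⟨this, i, ?_, hc.2⟩; rw [hc.1]
    · left; exact this
  | tree s h c m => exact ⟨_, hp, fun d hd => Or.inl (hpath d hd)⟩
  | bob i p => exact ⟨_, hp, fun d hd => Or.inl (hpath d hd)⟩
  | sel m => exact ⟨_, hb, fun d hd => Or.inl (by simpa [height] using hbob d hd)⟩
  | path k => exact ⟨_, hb, fun d hd => Or.inl (by simpa [height] using hbob d hd)⟩
  | pad k => exact ⟨_, hb, fun d hd => Or.inl (by simpa [height] using hbob d hd)⟩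

theorem far_of_not_mem {i : ℕ} (hi : i < 2 ^ L) (hyi : y i = false) {d : ℕ}
    (h : Near (nodeGraph L q x y) (alice i 0) (bob i (4 * L + 4)) d) : 6 * L + 10 ≤ d := by
  have := h.le_add_of_lipschitz _ (nodeGraph_lipschitz _ (shiftedHeight_lipschitz hi hyi))
  simp [shiftedHeight, height] at this
  omega

end NodeGraph

end Congest

namespace Congest

open Node

/-! ### Upper bounds on distances. -/

section UpperBounds

variable {L q : ℕ} {x y : ℕ → Bool}

theorem adj_of_link {a b : Node} (h : Link L x y a b) (ha : a.Valid L q) (hb : b.Valid L q)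
    (hne : a ≠ b) : (nodeGraph L q x y).Adj a b := ⟨hne, ha, hb, Or.inl h⟩

theorem two_pow_add_lt {i : ℕ} (hi : i < 2 ^ L) : 2 ^ L + i < 2 ^ (L + 1) := by
  rw [pow_succ]; omega

theorem near_alice_line {i h h' : ℕ} (hi : i < 2 ^ L) (hh : h ≤ h') (hL : h' ≤ L) :
    Near (nodeGraph L q x y) (alice i h) (alice i h') (h' - h) :=
  Near.of_line (l := L) (fun k => alice i k) (fun k hk => adj_of_link (.alice_line i k)
    ⟨hi, by omega⟩ ⟨hi, by omega⟩ (by simp)) hh hL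

theorem near_bob_line {i p p' : ℕ} (hi : i < 2 ^ L) (hp : p ≤ p') (hL : p' ≤ 4 * L + 4) :
    Near (nodeGraph L q x y) (bob i p) (bob i p') (p' - p) :=
  Near.of_line (l := 4 * L + 4) (fun k => bob i k) (fun k hk => adj_of_link (.bob_line i k)
    ⟨hi, by omega⟩ ⟨hi, by omega⟩ (by simp)) hp hL

theorem near_tree_root (s : Bool) {h : ℕ} (c : Bool) {m : ℕ} (hh : h ≤ L)
    (hm : m < 2 ^ (L + 1)) :
    Near (nodeGraph L q x y) (tree s h c m) (tree s h c 0) (L + 1) :=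
  (Near.of_heap (fun k => tree s h c k) (fun k => k / 2) (fun k => le_rfl)
    (fun k hk hk0 => adj_of_link (.heap s h c k) ⟨hh, hk⟩
      ⟨hh, lt_of_le_of_lt (Nat.div_le_self _ _) hk⟩ (by simp; omega)) hm).mono
    (size_le_of_lt hm)

theorem near_sel_root {m : ℕ} (hm : m < 2 ^ (L + 1)) :
    Near (nodeGraph L q x y) (sel m) (sel 0) (L + 1) :=
  (Near.of_heap (fun k => sel k) (fun k => k / 2) (fun k => le_rfl)
    (fun k hk hk0 => adj_of_link (.sel_heap k) hk
      (lt_of_le_of_lt (Nat.div_le_self _ _) hk) (by simp; omega)) hm).mono (size_le_of_lt hm)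

theorem near_pad_root {k : ℕ} (hk : k < q) :
    Near (nodeGraph L q x y) (pad k) (pad 0) k.size :=
  Near.of_heap (fun k => pad k) (fun k => k / 4) (fun k => by omega)
    (fun k hk hk0 => adj_of_link (.pad_heap k) hk
      (lt_of_le_of_lt (Nat.div_le_self _ _) hk) (by simp; omega)) hk

theorem near_alice_root {i h : ℕ} (hi : i < 2 ^ L) (hh : h ≤ L) :
    Near (nodeGraph L q x y) (alice i h) (tree true h (i.testBit h) 0) (L + 2) :=
  ((Near.of_adj (adj_of_link (.alice_leaf i h) ⟨hi, hh⟩ ⟨hh, two_pow_add_lt hi⟩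
    (by simp))).trans (near_tree_root true _ hh (two_pow_add_lt hi))).mono (by omega)

theorem near_bob_root {i h : ℕ} (hi : i < 2 ^ L) (hh : h ≤ L) :
    Near (nodeGraph L q x y) (bob i h) (tree false h (!i.testBit h) 0) (L + 2) :=
  ((Near.of_adj (adj_of_link (.bob_leaf i h) ⟨hi, by omega⟩ ⟨hh, two_pow_add_lt hi⟩
    (by simp))).trans (near_tree_root false _ hh (two_pow_add_lt hi))).mono (by omega)

theorem near_cut {h : ℕ} (c : Bool) (hh : h ≤ L) :
    Near (nodeGraph L q x y) (tree true h c 0) (tree false h c 0) 1 :=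
  Near.of_adj (adj_of_link (.cut h c) ⟨hh, by positivity⟩ ⟨hh, by positivity⟩ (by simp))

theorem testBit_top {i : ℕ} (hi : i < 2 ^ L) : i.testBit L = false := Nat.testBit_lt_two_pow hi

/-- The common tree joins the two lines of an index of the second player's set. -/
theorem near_bob_of_mem {i : ℕ} (hi : i < 2 ^ L) (hyi : y i = true) :
    Near (nodeGraph L q x y) (alice i 0) (bob i L) (3 * L + 5) := by
  have h1 := near_alice_root (q := q) (x := x) (y := y) hi (le_refl L)
  rw [testBit_top hi] at h1
  have h2 : Near (nodeGraph L q x y) (bob i L) (tree false L false (2 ^ L + i)) 1 :=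
    Near.of_adj (adj_of_link (.bob_input i hyi) ⟨hi, by omega⟩ ⟨le_rfl, two_pow_add_lt hi⟩
      (by simp))
  have h3 := h2.trans (near_tree_root false false le_rfl (two_pow_add_lt hi))
  exact ((near_alice_line hi (Nat.zero_le L) le_rfl).trans
    (h1.trans ((near_cut false le_rfl).trans h3.symm))).mono (by omega)

/-- A bit position in which the indices differ joins their lines. -/
theorem near_bob_of_testBit_ne {i j h : ℕ} (hi : i < 2 ^ L) (hj : j < 2 ^ L) (hh : h ≤ L)
    (hb : i.testBit h ≠ j.testBit h) :
    Near (nodeGraph L q x y) (alice i h) (bob j h) (2 * L + 5) := by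
  have h1 := near_alice_root (q := q) (x := x) (y := y) hi hh
  have h2 := near_bob_root (q := q) (x := x) (y := y) hj hh
  rw [← Bool.eq_not_of_ne hb] at h2
  exact (h1.trans ((near_cut _ hh).trans h2.symm)).mono (by omega)

theorem exists_testBit_ne {i j : ℕ} (hi : i < 2 ^ L) (hj : j < 2 ^ L) (hij : i ≠ j) :
    ∃ h ≤ L, i.testBit h ≠ j.testBit h := by
  by_contra! hcon
  refine hij (Nat.eq_of_testBit_eq fun h => ?_)
  rcases le_or_gt h L with hh | hh
  · exact hcon h hh
  · have : 2 ^ L ≤ 2 ^ h := Nat.pow_le_pow_right (by norm_num) hh.le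
    rw [Nat.testBit_lt_two_pow (hi.trans_le this), Nat.testBit_lt_two_pow (hj.trans_le this)]

/-- The slack `e` serves two uses: `e = 0` bounds the radius when `y i` holds, while an arbitrary
`e` suffices for connectedness. -/
theorem near_alice_of_near_bob {i e : ℕ} (hi : i < 2 ^ L) (hxi : x i = true)
    (hq : q ≤ 2 ^ (5 * L + 6))
    (hbob : Near (nodeGraph L q x y) (alice i 0) (bob i L) (3 * L + 5 + e)) (a : Node)
    (ha : a.Valid L q) : Near (nodeGraph L q x y) (alice i 0) a (6 * L + 9 + e) := by
  have hsel : Near (nodeGraph L q x y) (alice i 0) (sel 0) (L + 2) :=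
    ((Near.of_adj (adj_of_link (.alice_input i hxi) ⟨hi, by omega⟩ (two_pow_add_lt hi)
      (by simp))).trans (near_sel_root (two_pow_add_lt hi))).mono (by omega)
  cases a with
  | alice j h =>
    have h1 := near_alice_root (q := q) (x := x) (y := y) hi (le_refl L)
    have h2 := near_alice_root (q := q) (x := x) (y := y) ha.1 (le_refl L)
    rw [testBit_top hi] at h1
    rw [testBit_top ha.1] at h2
    exact ((near_alice_line hi (Nat.zero_le L) le_rfl).trans (h1.trans (h2.symm.trans
      (near_alice_line ha.1 ha.2 le_rfl).symm))).mono (by omega)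
  | tree s h c m =>
    refine Near.mono (Near.trans (d := 5 * L + 8 + e) ?_
      (near_tree_root s c ha.1 ha.2).symm) (by omega)
    rcases Bool.eq_or_eq_not c (i.testBit h) with hc | hc
    · have h1 : Near (nodeGraph L q x y) (alice i 0) (tree true h c 0) (2 * L + 2) := by
        rw [hc]
        exact ((near_alice_line hi (Nat.zero_le h) ha.1).trans
          (near_alice_root hi ha.1)).mono (by have := ha.1; omega)
      cases s with
      | true => exact h1.mono (by omega)
      | false => exact (h1.trans (near_cut c ha.1)).mono (by omega)
    -- Alice's line `i` misses the tree of the complementary bit, but Bob's line `i` enters it.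
    · have h1 : Near (nodeGraph L q x y) (alice i 0) (tree false h c 0) (5 * L + 7 + e) := by
        rw [hc]
        exact ((hbob.trans (near_bob_line hi ha.1 (by omega)).symm).trans
          (near_bob_root hi ha.1)).mono (by omega)
      cases s with
      | true => exact (h1.trans (near_cut c ha.1).symm).mono (by omega)
      | false => exact h1.mono (by omega)
  | bob j p =>
    by_cases hij : i = j
    · subst hij
      rcases le_total L p with hp | hp
      · exact (hbob.trans (near_bob_line hi hp ha.2)).mono (by have := ha.2; omega)
      · exact (hbob.trans (near_bob_line hi hp (by omega)).symm).mono (by omega)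
    · obtain ⟨h, hh, hb⟩ := exists_testBit_ne hi ha.1 hij
      have h1 := (near_alice_line (q := q) (x := x) (y := y) hi (Nat.zero_le h) hh).trans
        (near_bob_of_testBit_ne hi ha.1 hh hb)
      rcases le_total h p with hp | hp
      · exact (h1.trans (near_bob_line ha.1 hp ha.2)).mono (by have := ha.2; omega)
      · exact (h1.trans (near_bob_line ha.1 hp (by omega)).symm).mono (by omega)
  | sel m => exact (hsel.trans (near_sel_root ha).symm).mono (by omega)
  | path k =>
    have h1 : Near (nodeGraph L q x y) (path 0) (path k) (k - 0) :=
      Near.of_line (l := 5 * L + 6) (fun k => path k) (fun k hk => adj_of_link (.path_line k)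
        (show k ≤ 5 * L + 6 by omega) (show k + 1 ≤ 5 * L + 6 by omega) (by simp))
        (Nat.zero_le k) ha
    have h2 : Near (nodeGraph L q x y) (path 0) (sel 0) 1 :=
      Near.of_adj (adj_of_link .path_root (Nat.zero_le _)
        (show 0 < 2 ^ (L + 1) by positivity) (by simp))
    have h3 : k ≤ 5 * L + 6 := ha
    exact ((hsel.trans h2.symm).trans h1).mono (by omega)
  | pad k =>
    have hk : k < q := ha
    have h2 : Near (nodeGraph L q x y) (pad 0) (sel 0) 1 :=
      Near.of_adj (adj_of_link .pad_root (show 0 < q by omega)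
        (show 0 < 2 ^ (L + 1) by positivity) (by simp))
    have h3 : k.size ≤ 5 * L + 6 := Nat.size_le.2 (by omega)
    exact ((hsel.trans h2.symm).trans (near_pad_root hk).symm).mono (by omega)

/-- Without an input link, detour through another index `j`: Alice's lines `i` and `j` share the
tree of position `L`, and `j` differs from `i` in some bit. -/
theorem exists_near_bob (hL : 1 ≤ L) {i : ℕ} (hi : i < 2 ^ L) :
    ∃ e, Near (nodeGraph L q x y) (alice i 0) (bob i L) (3 * L + 5 + e) := by
  obtain ⟨j, hj, hij⟩ : ∃ j < 2 ^ L, j ≠ i := by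
    have : 2 ≤ 2 ^ L := by calc 2 = 2 ^ 1 := rfl
                             _ ≤ _ := Nat.pow_le_pow_right (by norm_num) hL
    by_cases h : i = 0
    · exact ⟨1, by omega, by omega⟩
    · exact ⟨0, by omega, by omega⟩
  obtain ⟨h, hh, hb⟩ := exists_testBit_ne hj hi hij
  have h1 := near_alice_root (q := q) (x := x) (y := y) hi (le_refl L)
  have h2 := near_alice_root (q := q) (x := x) (y := y) hj (le_refl L)
  rw [testBit_top hi] at h1
  rw [testBit_top hj] at h2
  have := ((near_alice_line hi (Nat.zero_le L) le_rfl).trans (h1.trans (h2.symm.trans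
      (near_alice_line hj hh le_rfl).symm))).trans ((near_bob_of_testBit_ne hj hi hh hb).trans
      (near_bob_line hi hh (by omega)))
  exact ⟨_, this.mono (Nat.le_add_left _ _)⟩

end UpperBounds

/-! ### Degrees. -/

section Degree

variable {L q : ℕ} {x y : ℕ → Bool}

/-- The possible neighbours of a node. -/
def neighborCandidates (L : ℕ) : Node → List Node
  | alice i h => [alice i (h + 1), alice i (h - 1), tree true h (i.testBit h) (2 ^ L + i),
      sel (2 ^ L + i)]
  | tree s h c m => [tree s h c (m / 2), tree s h c (2 * m), tree s h c (2 * m + 1),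
      tree (!s) h c 0, if s then alice (m - 2 ^ L) h else bob (m - 2 ^ L) h]
  | bob i p => [bob i (p + 1), bob i (p - 1), tree false p (!i.testBit p) (2 ^ L + i),
      tree false L false (2 ^ L + i)]
  | sel m => [sel (m / 2), sel (2 * m), sel (2 * m + 1),
      if m = 0 then path 0 else alice (m - 2 ^ L) 0, pad 0]
  | path k => [path (k + 1), path (k - 1), sel 0]
  | pad k => [if k = 0 then sel 0 else pad (k / 4), pad (4 * k), pad (4 * k + 1), pad (4 * k + 2),
      pad (4 * k + 3)]

theorem length_neighborCandidates_le (a : Node) : (neighborCandidates L a).length ≤ 5 := by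
  cases a <;> simp [neighborCandidates]

theorem mem_neighborCandidates {a b : Node} (h : (nodeGraph L q x y).Adj a b) :
    b ∈ neighborCandidates L a := by
  have hpos : 0 < 2 ^ L := by positivity
  obtain ⟨hne, -, -, h | h⟩ := h
  · cases h with
    | alice_line i h => simp [neighborCandidates]
    | alice_leaf i h => simp [neighborCandidates]
    | heap s h c m => simp [neighborCandidates]
    | cut h c => simp [neighborCandidates]
    | bob_leaf i h => simp [neighborCandidates]
    | bob_input i hy => simp [neighborCandidates]
    | bob_line i p => simp [neighborCandidates]
    | sel_heap m => simp [neighborCandidates]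
    | alice_input i hx => simp [neighborCandidates]
    | path_root => simp [neighborCandidates]
    | path_line k => simp [neighborCandidates]
    | pad_root => simp [neighborCandidates]
    | pad_heap k =>
      have hk : k ≠ 0 := by rintro rfl; simp at hne
      simp [neighborCandidates, hk]
  · cases h with
    | alice_line i h => simp [neighborCandidates]
    | alice_leaf i h => simp [neighborCandidates]
    | heap s h c m => simp [neighborCandidates]; omega
    | cut h c => simp [neighborCandidates]
    | bob_leaf i h => simp [neighborCandidates]
    | bob_input i hy => simp [neighborCandidates]
    | bob_line i p => simp [neighborCandidates]
    | sel_heap m => simp [neighborCandidates]; omega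
    | alice_input i hx => simp [neighborCandidates]
    | path_root => simp [neighborCandidates]
    | path_line k => simp [neighborCandidates]
    | pad_root => simp [neighborCandidates]
    | pad_heap k => simp [neighborCandidates]; omega

/-- A node of degree exactly five; its last child `pad 7` is why `8 ≤ q` is needed. -/
theorem pad_one_adj (hq : 8 ≤ q) : ∀ b ∈ [pad 0, pad 4, pad 5, pad 6, pad 7],
    (nodeGraph L q x y).Adj (pad 1) b := by
  have h : ∀ k, k / 4 = 1 → k < q → k ≠ 1 → (nodeGraph L q x y).Adj (pad 1) (pad k) := by
    intro k hk hkq hk1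
    have := adj_of_link (L := L) (q := q) (x := x) (y := y) (.pad_heap k) hkq
      (show k / 4 < q by omega) (by simp; omega)
    rw [hk] at this
    exact this.symm
  have h0 : (nodeGraph L q x y).Adj (pad 1) (pad 0) :=
    adj_of_link (.pad_heap 1) (show 1 < q by omega) (show 1 / 4 < q by omega) (by simp)
  intro b hb
  simp only [List.mem_cons, List.not_mem_nil, or_false] at hb
  rcases hb with rfl | rfl | rfl | rfl | rfl
  · exact h0
  all_goals exact h _ (by norm_num) (by omega) (by norm_num)

end Degree

end Congest

namespace Congest

open Node

/-! ### Transfer to `Fin n`, radius and cut. -/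

section Network

/-- The number of nodes other than padding nodes. -/
def coreSize (L : ℕ) : ℕ :=
  2 ^ L * (L + 1) + 2 * ((L + 1) * (2 * 2 ^ (L + 1))) + 2 ^ L * (4 * L + 5) + 2 ^ (L + 1) +
    (5 * L + 7)

theorem coreSize_le (L : ℕ) : coreSize L ≤ 23 * (2 ^ L * (L + 1)) := by
  have h : 1 ≤ 2 ^ L := Nat.one_le_two_pow
  unfold coreSize
  rw [pow_succ]
  nlinarith [Nat.zero_le L]

/-- The valid nodes as a disjoint union. -/
def validEquiv (L q : ℕ) :
    (Fin (2 ^ L) × Fin (L + 1)) ⊕ (Bool × Fin (L + 1) × Bool × Fin (2 ^ (L + 1))) ⊕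
      (Fin (2 ^ L) × Fin (4 * L + 5)) ⊕ Fin (2 ^ (L + 1)) ⊕ Fin (5 * L + 7) ⊕ Fin q ≃
      {a : Node // a.Valid L q} where
  toFun
    | .inl (i, h) => ⟨alice i h, i.2, Nat.lt_succ_iff.1 h.2⟩
    | .inr (.inl (s, h, c, m)) => ⟨tree s h c m, Nat.lt_succ_iff.1 h.2, m.2⟩
    | .inr (.inr (.inl (i, p))) => ⟨bob i p, i.2, Nat.lt_succ_iff.1 p.2⟩
    | .inr (.inr (.inr (.inl m))) => ⟨sel m, m.2⟩
    | .inr (.inr (.inr (.inr (.inl k)))) => ⟨path k, Nat.lt_succ_iff.1 k.2⟩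
    | .inr (.inr (.inr (.inr (.inr k)))) => ⟨pad k, k.2⟩
  invFun
    | ⟨alice i h, ha⟩ => .inl (⟨i, ha.1⟩, ⟨h, Nat.lt_succ_iff.2 ha.2⟩)
    | ⟨tree s h c m, ha⟩ => .inr (.inl (s, ⟨h, Nat.lt_succ_iff.2 ha.1⟩, c, ⟨m, ha.2⟩))
    | ⟨bob i p, ha⟩ => .inr (.inr (.inl (⟨i, ha.1⟩, ⟨p, Nat.lt_succ_iff.2 ha.2⟩)))
    | ⟨sel m, ha⟩ => .inr (.inr (.inr (.inl ⟨m, ha⟩)))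
    | ⟨path k, ha⟩ => .inr (.inr (.inr (.inr (.inl ⟨k, Nat.lt_succ_iff.2 ha⟩))))
    | ⟨pad k, ha⟩ => .inr (.inr (.inr (.inr (.inr ⟨k, ha⟩))))
  left_inv := by rintro (_ | _ | _ | _ | _ | _) <;> rfl
  right_inv := by rintro ⟨_ | _ | _ | _ | _ | _, _⟩ <;> rfl

theorem nonempty_fin_equiv_valid {n L q : ℕ} (hn : n = coreSize L + q) :
    Nonempty (Fin n ≃ {a : Node // a.Valid L q}) := by
  refine ⟨(Fintype.equivOfCardEq ?_).trans (validEquiv L q)⟩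
  simp only [Fintype.card_sum, Fintype.card_prod, Fintype.card_fin, Fintype.card_bool]
  rw [hn, coreSize]
  ring

variable {n L q : ℕ}

/-- The lower bound network on `Fin n`. -/
def network (e : Fin n ≃ {a : Node // a.Valid L q}) (x y : ℕ → Bool) : SimpleGraph (Fin n) :=
  (nodeGraph L q x y).comap fun a => (e a).1

/-- Invalid nodes are isolated, so a walk between valid nodes never leaves the image of `e`. -/
theorem near_network_iff (e : Fin n ≃ {a : Node // a.Valid L q}) (x y : ℕ → Bool) (a b : Fin n)
    (d : ℕ) : Near (network e x y) a b d ↔ Near (nodeGraph L q x y) (e a).1 (e b).1 d := by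
  constructor
  · rintro ⟨w, hw⟩
    let f : network e x y →g nodeGraph L q x y := ⟨fun a => (e a).1, fun h => h⟩
    exact ⟨w.map f, by rw [SimpleGraph.Walk.length_map]; exact hw⟩
  · rintro ⟨w, hw⟩
    have key : ∀ (u v : Node) (w : (nodeGraph L q x y).Walk u v), ∀ a b, (e a).1 = u →
        (e b).1 = v → Near (network e x y) a b w.length := by
      intro u v w
      induction w with
      | nil =>
        intro a b ha hb
        have : a = b := e.injective (Subtype.ext (ha.trans hb.symm))
        subst this
        exact Near.refl _ _ _
      | @cons u v' v hadj w ih =>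
        intro a b ha hb
        have hvalid : v'.Valid L q := hadj.2.2.1
        have hv : (e (e.symm ⟨v', hvalid⟩)).1 = v' := by simp
        have h1 := ih (e.symm ⟨v', hvalid⟩) b hv hb
        have h2 : (network e x y).Adj a (e.symm ⟨v', hvalid⟩) := by
          rw [network, SimpleGraph.comap_adj, hv, ha]; exact hadj
        refine ((Near.of_adj h2).trans h1).mono ?_
        rw [SimpleGraph.Walk.length_cons]; omega
    exact (key _ _ w a b rfl rfl).mono hw

theorem edist_le_iff_near {V : Type*} {G : SimpleGraph V} {a b : V} {d : ℕ} :
    G.edist a b ≤ d ↔ Near G a b d := by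
  constructor
  · intro h
    obtain ⟨w, hw⟩ := SimpleGraph.exists_walk_of_edist_ne_top (ne_top_of_le_ne_top (by simp) h)
    exact ⟨w, by rw [← hw] at h; exact_mod_cast h⟩
  · rintro ⟨w, hw⟩
    exact (SimpleGraph.edist_le w).trans (by exact_mod_cast hw)

theorem radius_le_iff_near {V : Type*} [Finite V] [Nonempty V] {G : SimpleGraph V} {d : ℕ} :
    G.radius ≤ d ↔ ∃ a, ∀ b, Near G a b d := by
  constructor
  · intro h
    obtain ⟨a, ha⟩ := G.exists_eccent_eq_radius
    refine ⟨a, fun b => edist_le_iff_near.1 ?_⟩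
    exact SimpleGraph.edist_le_eccent.trans (ha.le.trans h)
  · rintro ⟨a, ha⟩
    refine SimpleGraph.radius_le_eccent.trans (?_ : G.eccent a ≤ d)
    exact iSup_le fun b => edist_le_iff_near.2 (ha b)

theorem network_radius_eq_iff (e : Fin n ≃ {a : Node // a.Valid L q}) (hq : q ≤ 2 ^ (5 * L + 6))
    (x y : ℕ → Bool) :
    (network e x y).radius = (6 * L + 9 : ℕ) ↔ ∃ i < 2 ^ L, x i = true ∧ y i = true := by
  have hnode : ∀ {a : Node}, a.Valid L q → ∃ b : Fin n, (e b).1 = a := fun {a} ha =>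
    ⟨e.symm ⟨a, ha⟩, by simp⟩
  obtain ⟨o, -⟩ := hnode (show (path 0).Valid L q from Nat.zero_le _)
  have : Nonempty (Fin n) := ⟨o⟩
  constructor
  · intro h
    obtain ⟨a, ha⟩ := radius_le_iff_near.1 h.le
    obtain ⟨b, hb, hfar⟩ := exists_far_node (L := L) (q := q) (x := x) (y := y) (e a).1
    obtain ⟨b, rfl⟩ := hnode hb
    rcases hfar _ ((near_network_iff e x y a b _).1 (ha b)) with h1 | ⟨-, i, hai, hxi⟩
    · omega
    have hi : i < 2 ^ L := by
      have := (e a).2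
      rw [hai] at this
      exact this.1
    refine ⟨i, hi, hxi, ?_⟩
    by_contra hyi
    obtain ⟨b, hb⟩ := hnode (show (bob i (4 * L + 4)).Valid L q from ⟨hi, le_rfl⟩)
    have h2 := (near_network_iff e x y a b _).1 (ha b)
    rw [hai, hb] at h2
    have := far_of_not_mem hi (by simpa using hyi) h2
    omega
  · rintro ⟨i, hi, hxi, hyi⟩
    refine le_antisymm ?_ ?_
    · obtain ⟨a, ha⟩ := hnode (show (alice i 0).Valid L q from ⟨hi, Nat.zero_le _⟩)
      refine radius_le_iff_near.2 ⟨a, fun b => (near_network_iff e x y a b _).2 ?_⟩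
      rw [ha]
      exact near_alice_of_near_bob (e := 0) hi hxi hq (near_bob_of_mem hi hyi) _ (e b).2
    · have h1 : ¬ (network e x y).radius ≤ (6 * L + 8 : ℕ) := by
        intro h
        obtain ⟨a, ha⟩ := radius_le_iff_near.1 h
        obtain ⟨b, hb, hfar⟩ := exists_far_node (L := L) (q := q) (x := x) (y := y) (e a).1
        obtain ⟨b, rfl⟩ := hnode hb
        rcases hfar _ ((near_network_iff e x y a b _).1 (ha b)) with h1 | ⟨h1, -⟩ <;> omega
      rw [not_le] at h1
      exact_mod_cast Order.add_one_le_of_lt h1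

/-- Only input links of `x` join `sel`, the path and the padding to the rest, so `x` must contain
some index. -/
theorem network_connected (e : Fin n ≃ {a : Node // a.Valid L q}) (hL : 1 ≤ L)
    (hq : q ≤ 2 ^ (5 * L + 6)) {x y : ℕ → Bool} {i : ℕ} (hi : i < 2 ^ L) (hxi : x i = true) :
    (network e x y).Connected := by
  obtain ⟨d, hd⟩ := exists_near_bob (q := q) (x := x) (y := y) hL hi
  set a : Fin n := e.symm ⟨alice i 0, hi, Nat.zero_le _⟩ with ha
  have hreach : ∀ b, (network e x y).Reachable a b := by
    intro b
    have h : Near (nodeGraph L q x y) (e a).1 (e b).1 (6 * L + 9 + d) := by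
      have : (e a).1 = alice i 0 := by simp [ha]
      rw [this]
      exact near_alice_of_near_bob hi hxi hq hd _ (e b).2
    obtain ⟨w, -⟩ := (near_network_iff e x y a b _).2 h
    exact ⟨w⟩
  exact { preconnected := fun b c => (hreach b).symm.trans (hreach c), nonempty := ⟨a⟩ }

open scoped Classical in
theorem network_maxDegree (e : Fin n ≃ {a : Node // a.Valid L q}) (hq : 8 ≤ q)
    (x y : ℕ → Bool) : (network e x y).maxDegree = 5 := by
  apply le_antisymm
  · refine SimpleGraph.maxDegree_le_of_forall_degree_le _ _ fun a => ?_
    rw [← SimpleGraph.card_neighborFinset_eq_degree]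
    have hinj : Function.Injective (fun b : Fin n => (e b).1) :=
      Subtype.val_injective.comp e.injective
    rw [← Finset.card_image_of_injective _ hinj]
    refine (Finset.card_le_card (t := (neighborCandidates L (e a).1).toFinset) ?_).trans
      ((List.toFinset_card_le _).trans (length_neighborCandidates_le _))
    intro b hb
    obtain ⟨b, hab, rfl⟩ := Finset.mem_image.1 hb
    rw [SimpleGraph.mem_neighborFinset] at hab
    exact List.mem_toFinset.2 (mem_neighborCandidates hab)
  · set a : Fin n := e.symm ⟨pad 1, show 1 < q by omega⟩ with ha
    have hea : (e a).1 = pad 1 := by simp [ha]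
    refine le_trans ?_ (SimpleGraph.degree_le_maxDegree _ a)
    rw [← SimpleGraph.card_neighborFinset_eq_degree]
    have hinj : Function.Injective (fun b : Fin n => (e b).1) :=
      Subtype.val_injective.comp e.injective
    rw [← Finset.card_image_of_injective _ hinj]
    have h5 : ([pad 0, pad 4, pad 5, pad 6, pad 7] : List Node).toFinset.card = 5 := by
      rw [List.toFinset_card_of_nodup (by simp)]; rfl
    rw [← h5]
    refine Finset.card_le_card fun b hb => ?_
    have hadj := pad_one_adj (L := L) (x := x) (y := y) hq b (List.mem_toFinset.1 hb)
    have hvalid : b.Valid L q := hadj.2.2.1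
    have hb' : (e (e.symm ⟨b, hvalid⟩)).1 = b := by simp
    refine Finset.mem_image.2 ⟨e.symm ⟨b, hvalid⟩, ?_, hb'⟩
    rw [SimpleGraph.mem_neighborFinset, network, SimpleGraph.comap_adj, hb', hea]
    exact hadj

theorem nodeGraph_adj_left {x y y' : ℕ → Bool} {a b : Node} (ha : a.IsLeft)
    (h : (nodeGraph L q x y).Adj a b) : (nodeGraph L q x y').Adj a b := by
  obtain ⟨hne, hva, hvb, h⟩ := h
  refine ⟨hne, hva, hvb, h.imp (fun h => ?_) (fun h => ?_)⟩
  · cases h <;> first | exact absurd ha id | (constructor; assumption) | constructor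
  · cases h <;> first
      | exact absurd ha Bool.false_ne_true
      | (constructor; assumption)
      | constructor

theorem nodeGraph_adj_right {x x' y : ℕ → Bool} {a b : Node} (ha : ¬ a.IsLeft)
    (h : (nodeGraph L q x y).Adj a b) : (nodeGraph L q x' y).Adj a b := by
  obtain ⟨hne, hva, hvb, h⟩ := h
  refine ⟨hne, hva, hvb, h.imp (fun h => ?_) (fun h => ?_)⟩
  · cases h <;> first | exact absurd trivial ha | (constructor; assumption) | constructor
  · cases h <;> first | exact absurd trivial ha | (constructor; assumption) | constructor

theorem nodeGraph_adj_crossing {x y : ℕ → Bool} {a b : Node} (ha : a.IsLeft) (hb : ¬ b.IsLeft)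
    (h : (nodeGraph L q x y).Adj a b) :
    ∃ h ≤ L, ∃ c, a = tree true h c 0 ∧ b = tree false h c 0 := by
  obtain ⟨hne, hva, hvb, h | h⟩ := h
  · cases h <;> simp_all [IsLeft]
    exact hva.1
  · cases h <;> simp_all [IsLeft]

theorem network_isCut {X Y : Type*} (e : Fin n ≃ {a : Node // a.Valid L q}) (f : X → ℕ → Bool)
    (g : Y → ℕ → Bool) :
    IsCut (fun x y => network e (f x) (g y)) {a | (e a).1.IsLeft}
      (fun c : Fin (L + 1) × Bool =>
        e.symm ⟨tree true c.1 c.2 0, Nat.lt_succ_iff.1 c.1.2, by positivity⟩)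
      (fun c : Fin (L + 1) × Bool =>
        e.symm ⟨tree false c.1 c.2 0, Nat.lt_succ_iff.1 c.1.2, by positivity⟩) where
  adj_left a ha x y y' w h := nodeGraph_adj_left ha h
  adj_right a ha x x' y w h := nodeGraph_adj_right ha h
  crossing a ha w hw x y h := by
    obtain ⟨l, hl, c, h1, h2⟩ := nodeGraph_adj_crossing ha hw h
    refine ⟨(⟨l, Nat.lt_succ_iff.2 hl⟩, c), ?_, ?_⟩
    · rw [Equiv.eq_symm_apply]; exact Subtype.ext h1
    · rw [Equiv.eq_symm_apply]; exact Subtype.ext h2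

/-- The input `x`, preceded by a bit `c` and followed by zeros. -/
def extend {k : ℕ} (c : Bool) (x : Fin k → Bool) : ℕ → Bool
  | 0 => c
  | i + 1 => if h : i < k then x ⟨i, h⟩ else false

theorem exists_extend_iff {k m : ℕ} (hk : k < m) (x y : Fin k → Bool) :
    (∃ i < m, extend true x i = true ∧ extend false y i = true) ↔
      ∃ i, x i = true ∧ y i = true := by
  constructor
  · rintro ⟨_ | i, -, h1, h2⟩
    · simp [extend] at h2
    · simp only [extend] at h1 h2
      split_ifs at h1 h2 with h
      exact ⟨_, h1, h2⟩
  · rintro ⟨i, h1, h2⟩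
    exact ⟨i + 1, by omega, by simp [extend, h1], by simp [extend, h2]⟩

/-- Index `0` is always in Alice's set and never in Bob's: this keeps every network connected
without creating an intersection, and leaves `2 ^ L - 1` elements. -/
theorem rounds_lower_bound {Coins : Type u} [MeasurableSpace Coins]
    (μ : MeasureTheory.Measure Coins) [MeasureTheory.IsProbabilityMeasure μ] {b : ℕ}
    (P : Protocol.{u, v} Coins n b) {ε : ℝ} {T : ℕ} (hP : P.ComputesRadiusWithin μ ε T)
    (hn : n = coreSize L + q) (hL : 1 ≤ L) (hq8 : 8 ≤ q) (hq : q ≤ 2 ^ (5 * L + 6))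
    {t : ℝ} (ht : 0 < t) :
    (1 - 2 * ε) * (2 ^ L - 1) ≤
      16 * (4 * (b + 1) * T * (L + 1) + 2) / t + 2 * t * (2 ^ L - 1) := by
  obtain ⟨e⟩ := nonempty_fin_equiv_valid hn
  have hpos : 0 < 2 ^ L := by positivity
  have h := rounds_lower_bound_of_isCut (ι := Fin (2 ^ L - 1)) μ P
    (network_isCut e (extend (k := 2 ^ L - 1) true) (extend (k := 2 ^ L - 1) false))
    (fun x y => ⟨network_connected e hL hq hpos rfl, network_maxDegree e hq8 _ _⟩) (6 * L + 9)
    (fun x y => (network_radius_eq_iff e hq _ _).trans (exists_extend_iff (by omega) x y)) hP ht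
  simp only [Fintype.card_fin, Fintype.card_prod, Fintype.card_bool] at h
  rw [Nat.cast_sub hpos] at h
  push_cast at h
  convert h using 3
  ring

end Network

end Congest

/-! ### Choice of parameters and asymptotics. -/

namespace Congest

/-- A number of index bits for which the network has `n` nodes, a constant fraction of them
outside of the padding. -/
theorem exists_network_parameters {n : ℕ} (hn : 100 ≤ n) :
    ∃ L q : ℕ, n = coreSize L + q ∧ 1 ≤ L ∧ 8 ≤ q ∧ q ≤ 2 ^ (5 * L + 6) ∧ 2 ^ L ≤ n ∧
      n ≤ 100 * (2 ^ L * (L + 1)) := by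
  -- The constant `23` is from `coreSize_le`, and `8` is the least padding. At `L = 1` the condition
  -- reads `100 ≤ n`.
  set L := Nat.findGreatest (fun L => 23 * (2 ^ L * (L + 1)) + 8 ≤ n) n with hL
  have h1 : 23 * (2 ^ L * (L + 1)) + 8 ≤ n :=
    Nat.findGreatest_spec (P := fun L => 23 * (2 ^ L * (L + 1)) + 8 ≤ n) (Nat.zero_le n)
      (by norm_num; omega)
  have h2 : 1 ≤ L := Nat.le_findGreatest (by omega) (by norm_num; omega)
  have hpow : L < 2 ^ L := Nat.lt_two_pow_self
  have h3 : n < 23 * (2 ^ (L + 1) * (L + 1 + 1)) + 8 := by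
    by_contra! hcon
    have h4 : L + 1 ≤ n := by nlinarith
    have h5 : L + 1 ≤ L := Nat.le_findGreatest h4 hcon
    omega
  have h6 := coreSize_le L
  rw [pow_succ] at h3
  have h7 : n ≤ 100 * (2 ^ L * (L + 1)) := by nlinarith
  refine ⟨L, n - coreSize L, by omega, h2, by omega, ?_, by nlinarith, h7⟩
  calc n - coreSize L ≤ n := Nat.sub_le _ _
    _ ≤ 100 * (2 ^ L * (L + 1)) := h7
    _ ≤ 2 ^ 7 * (2 ^ L * 2 ^ L) := by gcongr <;> omega
    _ = 2 ^ (2 * L + 7) := by rw [← pow_add, ← pow_add]; congr 1; ring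
    _ ≤ _ := Nat.pow_le_pow_right (by norm_num) (by omega)

theorem eventually_log_le_mul {a : ℝ} (ha : 0 < a) :
    ∃ N : ℕ, ∀ n : ℕ, N ≤ n → Real.log n ≤ a * n := by
  have h := (Real.isLittleO_log_id_atTop.bound ha).and (Filter.eventually_ge_atTop (1 : ℝ))
  have h' := tendsto_natCast_atTop_atTop (R := ℝ) |>.eventually h
  obtain ⟨N, hN⟩ := Filter.eventually_atTop.1 h'
  refine ⟨N, fun n hn => ?_⟩
  have h1 := (hN n hn).1
  simp only [id, Real.norm_eq_abs, Nat.abs_cast] at h1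
  exact (le_abs_self _).trans h1

end Congest

theorem theorem5 (C ε : ℝ) (hε : ε < 1 / 2) :
    ∃ c : ℝ, 0 < c ∧ ∃ N : ℕ, ∀ n : ℕ, N ≤ n →
      ∀ b : ℕ, (b : ℝ) ≤ C * Real.log n →
      ∀ (Coins : Type u) [MeasurableSpace Coins] (μ : MeasureTheory.Measure Coins)
        [MeasureTheory.IsProbabilityMeasure μ]
        (P : Congest.Protocol.{u, v} Coins n b) (T : ℕ),
        P.ComputesRadiusWithin μ ε T → c * ((n : ℝ) / Real.log n ^ 3) ≤ (T : ℝ) := by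
  set δ := 1 - 2 * ε with hδ
  have hδ0 : 0 < δ := by linarith
  -- Here `307200 = 512 * 600`; it makes `δ ^ 2 * (K - 1) ≥ 512`, enough to absorb the additive
  -- constant of the transcript bound. Below, `1843200 = 600 * 1024 * 3`.
  obtain ⟨N, hN⟩ := Congest.eventually_log_le_mul (a := δ ^ 2 / 307200) (by positivity)
  refine ⟨δ ^ 2 / (1843200 * (|C| + 1)), by positivity, max N 100, fun n hn b hb => ?_⟩
  intro Coins _ μ _ P T hP
  have hn100 : 100 ≤ n := (le_max_right _ _).trans hn
  have hlogn := hN n ((le_max_left _ _).trans hn)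
  obtain ⟨L, q, hnq, hL, hq8, hq, h2L, hnL⟩ := Congest.exists_network_parameters hn100
  -- With `t = δ / 4` the term `2 * t * (2 ^ L - 1)` is half of the left side.
  have hmain := Congest.rounds_lower_bound μ P hP hnq hL hq8 hq (t := δ / 4) (by positivity)
  have hn100' : (100 : ℝ) ≤ n := by exact_mod_cast hn100
  have hnL' : (n : ℝ) ≤ 100 * (2 ^ L * (L + 1)) := by exact_mod_cast hnL
  have h2L' : (2 : ℝ) ^ L ≤ n := by exact_mod_cast h2L
  set l := Real.log n with hl
  have hl1 : 1 ≤ l := by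
    rw [hl, Real.le_log_iff_exp_le (by linarith)]
    linarith [Real.exp_one_lt_d9]
  have hLl : (L : ℝ) + 1 ≤ 3 * l := by
    have h := Real.log_le_log (by positivity) h2L'
    rw [Real.log_pow] at h
    nlinarith [Real.log_two_gt_d9, (Nat.cast_nonneg L : (0 : ℝ) ≤ L)]
  have hbl : (b : ℝ) + 1 ≤ (|C| + 1) * l := by nlinarith [le_abs_self C]
  set K : ℝ := 2 ^ L with hK
  have hK2 : 2 ≤ K := by
    calc (2 : ℝ) = 2 ^ 1 := by norm_num
      _ ≤ _ := pow_le_pow_right₀ (by norm_num) hL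
  have hT0 : (0 : ℝ) ≤ T := Nat.cast_nonneg T
  have hcore : δ ^ 2 * (K - 1) ≤ 128 * (4 * (b + 1) * T * (L + 1) + 2) := by
    rw [← hδ] at hmain
    have h1 : 16 * (4 * (b + 1) * T * (L + 1) + 2) / (δ / 4)
        = 64 * (4 * (b + 1) * T * (L + 1) + 2) / δ := by field_simp; norm_num
    rw [h1] at hmain
    have h2 : δ / 2 * (K - 1) ≤ 64 * (4 * (b + 1) * T * (L + 1) + 2) / δ := by linarith
    rw [le_div_iff₀ hδ0] at h2
    linarith
  have hnK : (n : ℝ) ≤ 600 * (K - 1) * l := by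
    have h1 : K * (L + 1) ≤ 2 * (K - 1) * (3 * l) := by
      apply mul_le_mul <;> linarith
    linarith
  have hbig : 512 ≤ δ ^ 2 * (K - 1) := by
    have h1 : l * 307200 ≤ δ ^ 2 * (600 * (K - 1) * l) := by
      calc l * 307200 ≤ δ ^ 2 * n := by linarith
        _ ≤ _ := by gcongr
    have h2 : l * 307200 ≤ l * (600 * (δ ^ 2 * (K - 1))) := by linarith
    have h3 := le_of_mul_le_mul_left h2 (by linarith)
    linarith
  have hT : δ ^ 2 * (K - 1) ≤ 1024 * ((b + 1) * T * (L + 1)) := by linarith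
  have hfin : δ ^ 2 * n ≤ 1843200 * (|C| + 1) * l ^ 3 * T := by
    calc δ ^ 2 * n ≤ δ ^ 2 * (600 * (K - 1) * l) := by gcongr
      _ = 600 * l * (δ ^ 2 * (K - 1)) := by ring
      _ ≤ 600 * l * (1024 * ((((|C| + 1) * l)) * T * (3 * l))) := by
          refine mul_le_mul_of_nonneg_left (hT.trans ?_) (by positivity)
          gcongr
      _ = _ := by ring
  rw [div_mul_div_comm, div_le_iff₀ (by positivity)]
  linarith
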